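/- Let $\mathcal{D}$ be a PDF-bounded probability distribution, that is, a distribution on $[0,1]$ that has a probability density function $f$ for which there are constants $\alpha,\beta>0$ with $\alpha\le f(x)\le\beta$ for all $x\in[0,1]$. There are $n$ agents and $m$ chores, and the disutilities $d_i(j)$ of agent $i\in\{1,\dots,n\}$ for chore $j\in\{1,\dots,m\}$ are drawn independently from $\mathcal{D}$; put $d_i(S)=\sum_{j\in S}d_i(j)$ for every set $S$ of chores. An allocation is a partition $A=(A_1,\dots,A_n)$ of the chores into $n$ (possibly empty) bundles, and it is envy-free if $d_i(A_i)\le d_i(A_{i'})$ for all agents $i,i'$. Then there is a (deterministic) algorithm which, given $n$, $m$ and the matrix $(d_i(j))$ of real numbers as input, always halts within a number of steps that is polynomial in $n+m$ (where the addition, subtraction or comparison of two real numbers counts as one step), and which, if $2n\le m\le n^{8/7}$, outputs an envy-free allocation with high probability: for every $\varepsilon>0$ there is an $n_0$ such that, for all $n\ge n_0$ and all $m$ with $2n\le m\le n^{8/7}$, the algorithm outputs an envy-free allocation with probability at least $1-\varepsilon$. -/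

import Mathlib

open MeasureTheory Filter Topology

noncomputable section

namespace ChoreDivision

/-! ### Chores, allocations, envy-freeness -/

/-- The additive disutility of agent `i` for a set `S` of chores. -/
def disutility {n m : ℕ} (d : Fin n → Fin m → ℝ) (i : Fin n) (S : Finset (Fin m)) : ℝ :=
  ∑ j ∈ S, d i j

/-- An allocation of the chores `Fin m` to the agents `Fin n` is given by the owner of every chore;
the bundle of agent `i` is the set of the chores that `i` owns.  In this way allocations are
exactly the ordered partitions of the chores into `n` (possibly empty) bundles. -/
def bundle {n m : ℕ} (A : Fin m → Fin n) (i : Fin n) : Finset (Fin m) :=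
  Finset.univ.filter (fun j => A j = i)

/-- No agent has more disutility for her own bundle than for the bundle of another agent. -/
def EnvyFree {n m : ℕ} (d : Fin n → Fin m → ℝ) (A : Fin m → Fin n) : Prop :=
  ∀ i i' : Fin n, disutility d i (bundle A i) ≤ disutility d i (bundle A i')

/-! ### The random instance -/

/-- `D` is a distribution on `[0, 1]` with a density that lies between two positive constants
everywhere on `[0, 1]`. -/
def PDFBounded (D : Measure ℝ) : Prop :=
  ∃ α β : ℝ, 0 < α ∧ 0 < β ∧ ∃ f : ℝ → ℝ, Measurable f ∧
    (∀ x ∈ Set.Icc (0 : ℝ) 1, α ≤ f x ∧ f x ≤ β) ∧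
    D = (volume.restrict (Set.Icc (0 : ℝ) 1)).withDensity (fun x => ENNReal.ofReal (f x))

/-- The law of an instance with `n` agents and `m` chores whose `n * m` disutilities are drawn
independently from `D`. -/
def instanceLaw (D : Measure ℝ) (n m : ℕ) : Measure (Fin n → Fin m → ℝ) :=
  Measure.pi (fun _ : Fin n => Measure.pi (fun _ : Fin m => D))

/-! ### The machine model

A real random-access machine, programmed in a structured language.  The memory consists of arrays
of natural numbers and of arrays of real numbers, all of them initially `0` everywhere.  A program
knows `n` and `m`, and can read the entries of the input matrix.  Natural numbers and reals may be
added and subtracted (not multiplied or rounded), and compared, and the only real constants are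
those produced from `1`; a real value influences natural numbers, and so the control flow and the
output, only through comparisons.  Every assignment and every test costs one step. Since a fixed
program contains only finitely many expressions, each one stands for a bounded number of elementary
operations; and since all operations are additive, `t` steps on rational inputs of `b` bits can be
simulated in bit time polynomial in `t`, `b`, `log n` and `log m`. -/

/-- Expressions with natural number values. `arr a e` is the entry with index `e` of the array
number `a`. -/
inductive NExp : Type
  | const (k : ℕ)
  | agents
  | chores
  | arr (a : ℕ) (e : NExp)
  | add (e₁ e₂ : NExp)
  | sub (e₁ e₂ : NExp)

/-- Expressions with real values. `input e₁ e₂` is the disutility of agent `e₁` for chore `e₂`. -/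
inductive RExp : Type
  | one
  | input (e₁ e₂ : NExp)
  | arr (a : ℕ) (e : NExp)
  | add (e₁ e₂ : RExp)
  | sub (e₁ e₂ : RExp)

/-- Tests. -/
inductive Test : Type
  | natLe (e₁ e₂ : NExp)
  | realLe (e₁ e₂ : RExp)
  | neg (b : Test)
  | both (b₁ b₂ : Test)

/-- Programs. `setNat a e v` stores the value of `v` in the entry with index `e` of the array
number `a` of natural numbers, and `setReal` does the same for arrays of reals. -/
inductive Prog : Type
  | skip
  | setNat (a : ℕ) (e v : NExp)
  | setReal (a : ℕ) (e : NExp) (v : RExp)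
  | seq (p q : Prog)
  | ifElse (b : Test) (p q : Prog)
  | loop (b : Test) (p : Prog)

/-- The memory: the array number `a` has the entry `nat a k` (or `real a k`) at index `k`. -/
structure Memory : Type where
  nat : ℕ → ℕ → ℕ
  real : ℕ → ℕ → ℝ

/-- The memory at the start of every run. -/
def Memory.init : Memory := ⟨fun _ _ => 0, fun _ _ => 0⟩

section semantics

variable {n m : ℕ} (d : Fin n → Fin m → ℝ)

/-- Access to the input; reading outside of the matrix gives `0`. -/
def readInput (i j : ℕ) : ℝ :=
  if h : i < n ∧ j < m then d ⟨i, h.1⟩ ⟨j, h.2⟩ else 0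

/-- The value of a natural number expression, for `n` agents and `m` chores; subtraction is
truncated at `0`. -/
def NExp.val (n m : ℕ) (s : Memory) : NExp → ℕ
  | .const k => k
  | .agents => n
  | .chores => m
  | .arr a e => s.nat a (e.val n m s)
  | .add e₁ e₂ => e₁.val n m s + e₂.val n m s
  | .sub e₁ e₂ => e₁.val n m s - e₂.val n m s

/-- The value of a real expression on the input `d`. -/
def RExp.val (s : Memory) : RExp → ℝ
  | .one => 1
  | .input e₁ e₂ => readInput d (e₁.val n m s) (e₂.val n m s)
  | .arr a e => s.real a (e.val n m s)
  | .add e₁ e₂ => e₁.val s + e₂.val s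
  | .sub e₁ e₂ => e₁.val s - e₂.val s

/-- The truth value of a test on the input `d`. -/
def Test.Holds (s : Memory) : Test → Prop
  | .natLe e₁ e₂ => e₁.val n m s ≤ e₂.val n m s
  | .realLe e₁ e₂ => e₁.val d s ≤ e₂.val d s
  | .neg b => ¬ b.Holds s
  | .both b₁ b₂ => b₁.Holds s ∧ b₂.Holds s

/-- Writing `v` into the entry with index `k` of the array number `a` of natural numbers. -/
def Memory.writeNat (s : Memory) (a k v : ℕ) : Memory :=
  { s with nat := Function.update s.nat a (Function.update (s.nat a) k v) }

/-- Writing `v` into the entry with index `k` of the array number `a` of reals. -/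
def Memory.writeReal (s : Memory) (a k : ℕ) (v : ℝ) : Memory :=
  { s with real := Function.update s.real a (Function.update (s.real a) k v) }

/-- `Exec d p s s' t`: on the input `d`, the program `p` started with memory `s` halts after
exactly `t` steps with memory `s'`. -/
inductive Exec : Prog → Memory → Memory → ℕ → Prop
  | skip (s : Memory) : Exec .skip s s 0
  | setNat (a : ℕ) (e v : NExp) (s : Memory) :
      Exec (.setNat a e v) s (s.writeNat a (e.val n m s) (v.val n m s)) 1
  | setReal (a : ℕ) (e : NExp) (v : RExp) (s : Memory) :
      Exec (.setReal a e v) s (s.writeReal a (e.val n m s) (v.val d s)) 1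
  | seq {p q : Prog} {s₁ s₂ s₃ : Memory} {t₁ t₂ : ℕ} :
      Exec p s₁ s₂ t₁ → Exec q s₂ s₃ t₂ → Exec (.seq p q) s₁ s₃ (t₁ + t₂)
  | ifTrue {b : Test} {p q : Prog} {s s' : Memory} {t : ℕ} :
      b.Holds d s → Exec p s s' t → Exec (.ifElse b p q) s s' (t + 1)
  | ifFalse {b : Test} {p q : Prog} {s s' : Memory} {t : ℕ} :
      ¬ b.Holds d s → Exec q s s' t → Exec (.ifElse b p q) s s' (t + 1)
  | loopDone {b : Test} {p : Prog} {s : Memory} :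
      ¬ b.Holds d s → Exec (.loop b p) s s 1
  | loopStep {b : Test} {p : Prog} {s₁ s₂ s₃ : Memory} {t₁ t₂ : ℕ} :
      b.Holds d s₁ → Exec p s₁ s₂ t₁ → Exec (.loop b p) s₂ s₃ t₂ →
      Exec (.loop b p) s₁ s₃ (t₁ + t₂ + 1)

/-- Runs are deterministic: the final memory and the number of steps are unique. -/
theorem Exec.unique {p : Prog} {s s' s'' : Memory} {t t' : ℕ}
    (h : Exec d p s s' t) (h' : Exec d p s s'' t') : s' = s'' ∧ t = t' := by
  induction h generalizing s'' t' with
  | skip => cases h'; exact ⟨rfl, rfl⟩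
  | setNat => cases h'; exact ⟨rfl, rfl⟩
  | setReal => cases h'; exact ⟨rfl, rfl⟩
  | seq _ _ ih₁ ih₂ =>
    cases h' with
    | seq k₁ k₂ =>
      obtain ⟨rfl, rfl⟩ := ih₁ k₁
      obtain ⟨rfl, rfl⟩ := ih₂ k₂
      exact ⟨rfl, rfl⟩
  | ifTrue hb _ ih =>
    cases h' with
    | ifTrue _ k => obtain ⟨rfl, rfl⟩ := ih k; exact ⟨rfl, rfl⟩
    | ifFalse hb' _ => exact absurd hb hb'
  | ifFalse hb _ ih =>
    cases h' with
    | ifTrue hb' _ => exact absurd hb' hb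
    | ifFalse _ k => obtain ⟨rfl, rfl⟩ := ih k; exact ⟨rfl, rfl⟩
  | loopDone hb =>
    cases h' with
    | loopDone => exact ⟨rfl, rfl⟩
    | loopStep hb' _ _ => exact absurd hb' hb
  | loopStep hb _ _ ih₁ ih₂ =>
    cases h' with
    | loopDone hb' => exact absurd hb hb'
    | loopStep _ k₁ k₂ =>
      obtain ⟨rfl, rfl⟩ := ih₁ k₁
      obtain ⟨rfl, rfl⟩ := ih₂ k₂
      exact ⟨rfl, rfl⟩

/-- On the input `d`, the program `p` halts and outputs the allocation `A`: at the end, for every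
chore `j`, the entry `j` of the array number `0` of natural numbers is the owner of `j`.  A run that
ends with any other content of these entries outputs no allocation. -/
def Outputs (p : Prog) (A : Fin m → Fin n) : Prop :=
  ∃ (s : Memory) (t : ℕ), Exec d p Memory.init s t ∧ ∀ j : Fin m, s.nat 0 j = (A j : ℕ)

/-- On the input `d`, the program `p` halts and outputs an envy-free allocation. -/
def FindsEnvyFree (p : Prog) : Prop :=
  ∃ A : Fin m → Fin n, Outputs d p A ∧ EnvyFree d A

end semantics

/-- On every input, the program halts within a number of steps that is polynomial in the number of
agents and chores. -/
def RunsInPolynomialTime (p : Prog) : Prop :=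
  ∃ P : Polynomial ℕ, ∀ (n m : ℕ) (d : Fin n → Fin m → ℝ),
    ∃ (s : Memory) (t : ℕ), Exec d p Memory.init s t ∧ t ≤ P.eval (n + m)

end ChoreDivision

end

/-!
The algorithm assigns the chores in blocks of `n`. Each block is matched injectively into the agents,
so that every chore `j` goes to an agent `i` with `n * d i j ≤ ρ`, where `ρ = scale n` is of the order
`(log n) ^ 2`. A bundle then has at most `numBlocks n m` chores, and its owner has disutility at most
`S / n` for it, where `S = numBlocks n m * ρ`. An agent `i` who envies `i'` has disutility at most
`S / n` for each chore of `i'`, in particular for those from the first two blocks, which are full as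
`2 * n ≤ m`. The matching of the second block avoids exactly this: `i'` must not get the chore `j` if
some other agent has disutility at most `S / n` both for `j` and for the chore of `i'` from the first
block (`Allowed`, `envyFree_of_blocks`).

The matchings exist with high probability because Hall's condition holds. In every block, the graph of
the pairs with `n * d i j ≤ ρ` has average degree of the order `(log n) ^ 2` and is expanding
(`measure_not_expanding_le`), so much so that deleting at most two edges at each vertex preserves
Hall's condition (`hallCondition_of_expanding`). A forbidden edge of the second block completes a cycle
of length four in the sparse random graph of all entries at most `S / n`. If three agents were
forbidden one chore, or two chores were forbidden one agent, two such cycles would meet in a vertex,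
and their union would be a graph of bounded size with more edges than vertices. Each of the five
possible shapes is unlikely by the union bound (`measure_pattern_le`): the expected number of its
occurrences is at most of the order `S ^ 4 * ρ ^ 4 / n`, which tends to `0`, as `S` is at most
`2 * n ^ (1 / 7) * ρ` for `m ≤ n ^ (8 / 7)` (`eventually_typical`).

The matchings are found by an auction with integer prices: a chore without owner takes an allowed
agent of least price, whose price rises by one. Under Hall's condition no price exceeds `n`
(`AuctionInv.exists_price_lt`), so that there are at most `n * n` bids per block
(`BlockInv.auction`). The program consists of counted loops only; all such programs run in polynomial
time (`FProg.exec_compile`), and their effect on the memory is the function `FProg.run`.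
-/

noncomputable section

namespace ChoreDivision

/-! ### Programs with bounded loops only -/

/-- The fragment of the programming language in which all loops are counted: `forTo x c p` runs `p`
with the scalar `x` (the entry `0` of the array number `x`) going through all chores if `c` is
`true`, and through all agents if `c` is `false`. -/
inductive FProg : Type
  | setNat (a : ℕ) (e v : NExp)
  | setReal (a : ℕ) (e : NExp) (v : RExp)
  | seq (p q : FProg)
  | ifThen (b : Test) (p : FProg)
  | forTo (x : ℕ) (c : Bool) (p : FProg)

namespace FProg

/-- The expression for the number of iterations of a counted loop. -/
def boundExp (c : Bool) : NExp := if c then .chores else .agents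

/-- The number of iterations of a counted loop. -/
def bound (n m : ℕ) (c : Bool) : ℕ := if c then m else n

/-- The translation into the programming language. -/
def compile : FProg → Prog
  | setNat a e v => .setNat a e v
  | setReal a e v => .setReal a e v
  | seq p q => .seq p.compile q.compile
  | ifThen b p => .ifElse b p.compile .skip
  | forTo x c p => .seq (.setNat x (.const 0) (.const 0))
      (.loop (.neg (.natLe (boundExp c) (.arr x (.const 0))))
        (.seq p.compile (.setNat x (.const 0) (.add (.arr x (.const 0)) (.const 1)))))

/-- The memory at the start of the iteration number `k` of a loop with counter `x`, whose body acts
by `f`. -/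
def iter (x : ℕ) (f : Memory → Memory) (s : Memory) : ℕ → Memory
  | 0 => s.writeNat x 0 0
  | k + 1 => (f (iter x f s k)).writeNat x 0 (k + 1)

open Classical in
/-- The effect of a program on the memory. -/
def run {n m : ℕ} (d : Fin n → Fin m → ℝ) : FProg → Memory → Memory
  | setNat a e v, s => s.writeNat a (e.val n m s) (v.val n m s)
  | setReal a e v, s => s.writeReal a (e.val n m s) (v.val d s)
  | seq p q, s => q.run d (p.run d s)
  | ifThen b p, s => if b.Holds d s then p.run d s else s
  | forTo x c p, s => iter x (p.run d) s (bound n m c)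

/-- Whether the program may write to the array number `a` of natural numbers. -/
def writesNat : FProg → ℕ → Bool
  | setNat b _ _, a => a == b
  | setReal _ _ _, _ => false
  | seq p q, a => p.writesNat a || q.writesNat a
  | ifThen _ p, a => p.writesNat a
  | forTo x _ p, a => a == x || p.writesNat a

/-- Whether the program may write to the array number `a` of reals. -/
def writesReal : FProg → ℕ → Bool
  | setNat _ _ _, _ => false
  | setReal b _ _, a => a == b
  | seq p q, a => p.writesReal a || q.writesReal a
  | ifThen _ p, a => p.writesReal a
  | forTo _ _ p, a => p.writesReal a

/-- Bodies of loops do not write to the counter. -/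
def wellFormed : FProg → Bool
  | setNat _ _ _ => true
  | setReal _ _ _ => true
  | seq p q => p.wellFormed && q.wellFormed
  | ifThen _ p => p.wellFormed
  | forTo x _ p => !p.writesNat x && p.wellFormed

end FProg

/-! ### The memory after a run -/

@[simp] theorem Memory.writeNat_nat_self (s : Memory) (a k v : ℕ) :
    (s.writeNat a k v).nat a = Function.update (s.nat a) k v := by
  simp [Memory.writeNat]

theorem Memory.writeNat_nat_of_ne (s : Memory) {a b : ℕ} (k v : ℕ) (h : b ≠ a) :
    (s.writeNat a k v).nat b = s.nat b := by
  simp [Memory.writeNat, h]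

@[simp] theorem Memory.writeNat_real (s : Memory) (a k v : ℕ) :
    (s.writeNat a k v).real = s.real := rfl

@[simp] theorem Memory.writeReal_real_self (s : Memory) (a k : ℕ) (v : ℝ) :
    (s.writeReal a k v).real a = Function.update (s.real a) k v := by
  simp [Memory.writeReal]

theorem Memory.writeReal_real_of_ne (s : Memory) {a b : ℕ} (k : ℕ) (v : ℝ) (h : b ≠ a) :
    (s.writeReal a k v).real b = s.real b := by
  simp [Memory.writeReal, h]

@[simp] theorem Memory.writeReal_nat (s : Memory) (a k : ℕ) (v : ℝ) :
    (s.writeReal a k v).nat = s.nat := rfl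

namespace FProg

section

variable {n m : ℕ} (d : Fin n → Fin m → ℝ)

theorem run_ifThen_of_holds {b : Test} {p : FProg} {s : Memory} (h : b.Holds d s) :
    (ifThen b p).run d s = p.run d s := by
  simp only [run, if_pos h]

theorem run_ifThen_of_not_holds {b : Test} {p : FProg} {s : Memory} (h : ¬ b.Holds d s) :
    (ifThen b p).run d s = s := by
  simp only [run, if_neg h]

theorem run_nat_eq (p : FProg) (s : Memory) {a : ℕ} (h : p.writesNat a = false) :
    (p.run d s).nat a = s.nat a := by
  induction p generalizing s with
  | setNat b e v =>
    simp only [writesNat, beq_eq_false_iff_ne] at h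
    exact Memory.writeNat_nat_of_ne _ _ _ h
  | setReal => rfl
  | seq p q ihp ihq =>
    simp only [writesNat, Bool.or_eq_false_iff] at h
    simp only [run]
    rw [ihq _ h.2, ihp _ h.1]
  | ifThen b p ih =>
    simp only [run]
    split_ifs
    · exact ih _ h
    · rfl
  | forTo x c p ih =>
    simp only [writesNat, Bool.or_eq_false_iff, beq_eq_false_iff_ne] at h
    simp only [run]
    induction bound n m c with
    | zero => exact Memory.writeNat_nat_of_ne _ _ _ h.1
    | succ k ihk => rw [iter, Memory.writeNat_nat_of_ne _ _ _ h.1, ih _ h.2, ihk]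

theorem run_real_eq (p : FProg) (s : Memory) {a : ℕ} (h : p.writesReal a = false) :
    (p.run d s).real a = s.real a := by
  induction p generalizing s with
  | setNat => rfl
  | setReal b e v =>
    simp only [writesReal, beq_eq_false_iff_ne] at h
    exact Memory.writeReal_real_of_ne _ _ _ h
  | seq p q ihp ihq =>
    simp only [writesReal, Bool.or_eq_false_iff] at h
    simp only [run]
    rw [ihq _ h.2, ihp _ h.1]
  | ifThen b p ih =>
    simp only [run]
    split_ifs
    · exact ih _ h
    · rfl
  | forTo x c p ih =>
    simp only [writesReal] at h
    simp only [run]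
    induction bound n m c with
    | zero => rfl
    | succ k ihk => rw [iter, Memory.writeNat_real, ih _ h, ihk]

theorem iter_counter (x : ℕ) (f : Memory → Memory) (s : Memory) (k : ℕ) :
    (iter x f s k).nat x 0 = k := by
  cases k <;> simp [iter]

/-- Induction over the iterations of a counted loop; the arrays to which the loop does not write keep
their contents throughout. -/
theorem run_forTo_induction {x : ℕ} {c : Bool} {p : FProg} {s : Memory} (I : ℕ → Memory → Prop)
    (h0 : I 0 (s.writeNat x 0 0))
    (hs : ∀ k < bound n m c, ∀ s' : Memory, s'.nat x 0 = k →
      (∀ a, (forTo x c p).writesNat a = false → s'.nat a = s.nat a) →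
      (∀ a, (forTo x c p).writesReal a = false → s'.real a = s.real a) → I k s' →
      I (k + 1) ((p.run d s').writeNat x 0 (k + 1))) :
    I (bound n m c) ((forTo x c p).run d s) := by
  have key : ∀ k ≤ bound n m c, I k (iter x (p.run d) s k) ∧
      (∀ a, (forTo x c p).writesNat a = false → (iter x (p.run d) s k).nat a = s.nat a) ∧
      (∀ a, (forTo x c p).writesReal a = false → (iter x (p.run d) s k).real a = s.real a) := by
    intro k
    induction k with
    | zero =>
      refine fun _ => ⟨h0, fun a ha => ?_, fun a _ => rfl⟩
      simp only [writesNat, Bool.or_eq_false_iff, beq_eq_false_iff_ne] at ha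
      exact Memory.writeNat_nat_of_ne _ _ _ ha.1
    | succ k ih =>
      intro hk
      obtain ⟨h1, h2, h3⟩ := ih (by omega)
      refine ⟨hs k hk _ (iter_counter _ _ _ _) h2 h3 h1, fun a ha => ?_, fun a ha => ?_⟩
      · rw [← h2 a ha]
        simp only [writesNat, Bool.or_eq_false_iff, beq_eq_false_iff_ne] at ha
        rw [iter, Memory.writeNat_nat_of_ne _ _ _ ha.1, run_nat_eq d p _ ha.2]
      · rw [← h3 a ha]
        exact run_real_eq d p _ ha
  exact (key _ le_rfl).1

/-- The part of a counted loop from the iteration `k` on, with `l` iterations to go. -/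
theorem exec_loop {x : ℕ} {c : Bool} {p : FProg} {s : Memory} {T : ℕ}
    (hx : p.writesNat x = false)
    (hp : ∀ s, ∃ t, Exec d p.compile s (p.run d s) t ∧ t ≤ T) (l k : ℕ)
    (hk : k + l = bound n m c) :
    ∃ t, Exec d (.loop (.neg (.natLe (boundExp c) (.arr x (.const 0))))
        (.seq p.compile (.setNat x (.const 0) (.add (.arr x (.const 0)) (.const 1)))))
        (iter x (p.run d) s k) (iter x (p.run d) s (bound n m c)) t ∧ t ≤ l * (T + 2) + 1 := by
  have hB : ∀ s : Memory, (boundExp c).val n m s = bound n m c := by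
    intro s; cases c <;> rfl
  induction l generalizing k with
  | zero =>
    obtain rfl : k = bound n m c := by omega
    refine ⟨1, Exec.loopDone ?_, by omega⟩
    simp [Test.Holds, hB, NExp.val, iter_counter]
  | succ l ih =>
    obtain ⟨t₁, h₁, ht₁⟩ := hp (iter x (p.run d) s k)
    obtain ⟨t₂, h₂, ht₂⟩ := ih (k + 1) (by omega)
    have hnext : iter x (p.run d) s (k + 1) = (p.run d (iter x (p.run d) s k)).writeNat x
        ((NExp.const 0).val n m (p.run d (iter x (p.run d) s k)))
        ((NExp.add (.arr x (.const 0)) (.const 1)).val n m (p.run d (iter x (p.run d) s k))) := by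
      simp only [NExp.val, run_nat_eq d p _ hx, iter_counter]
      rfl
    rw [hnext] at h₂
    refine ⟨_, Exec.loopStep ?_ (Exec.seq h₁ (Exec.setNat _ _ _ _)) h₂, ?_⟩
    · simp only [Test.Holds, hB, NExp.val, iter_counter]; omega
    · rw [Nat.succ_mul]; omega

end

/-- A program with counted loops computes its effect within a polynomial number of steps. -/
theorem exec_compile (p : FProg) (hp : p.wellFormed = true) :
    ∃ P : Polynomial ℕ, ∀ (n m : ℕ) (d : Fin n → Fin m → ℝ) (s : Memory),
      ∃ t, Exec d p.compile s (p.run d s) t ∧ t ≤ P.eval (n + m) := by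
  induction p with
  | setNat a e v => exact ⟨1, fun n m d s => ⟨1, Exec.setNat _ _ _ _, by simp⟩⟩
  | setReal a e v => exact ⟨1, fun n m d s => ⟨1, Exec.setReal _ _ _ _, by simp⟩⟩
  | seq p q ihp ihq =>
    simp only [wellFormed, Bool.and_eq_true] at hp
    obtain ⟨P, hP⟩ := ihp hp.1
    obtain ⟨Q, hQ⟩ := ihq hp.2
    refine ⟨P + Q, fun n m d s => ?_⟩
    obtain ⟨t₁, h₁, ht₁⟩ := hP n m d s
    obtain ⟨t₂, h₂, ht₂⟩ := hQ n m d (p.run d s)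
    exact ⟨_, Exec.seq h₁ h₂, by rw [Polynomial.eval_add]; omega⟩
  | ifThen b p ih =>
    obtain ⟨P, hP⟩ := ih hp
    refine ⟨P + 1, fun n m d s => ?_⟩
    obtain ⟨t, h, ht⟩ := hP n m d s
    by_cases hb : b.Holds d s
    · refine ⟨t + 1, ?_, by simpa using ht⟩
      simp only [run, if_pos hb]
      exact Exec.ifTrue hb h
    · refine ⟨0 + 1, ?_, by simp⟩
      simp only [run, if_neg hb]
      exact Exec.ifFalse hb (Exec.skip _)
  | forTo x c p ih =>
    simp only [wellFormed, Bool.and_eq_true, Bool.not_eq_true'] at hp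
    obtain ⟨P, hP⟩ := ih hp.2
    refine ⟨1 + (Polynomial.X * (P + 2) + 1), fun n m d s => ?_⟩
    obtain ⟨t, h, ht⟩ := exec_loop d (c := c) (s := s) hp.1 (hP n m d) (bound n m c) 0 (by omega)
    refine ⟨_, Exec.seq (Exec.setNat _ _ _ _) h, ?_⟩
    have hb : bound n m c ≤ n + m := by cases c <;> simp [bound]
    have := Nat.mul_le_mul_right (P.eval (n + m) + 2) hb
    simp only [Polynomial.eval_add, Polynomial.eval_mul, Polynomial.eval_one, Polynomial.eval_X,
      Polynomial.eval_ofNat]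
    omega

end FProg

/-! ### Bipartite matching by an auction -/

open Classical in
/-- Hall's condition for the bidders in `J`, where `A j i` says that the bidder `j` accepts the
object `i < n`. -/
def HallCondition (n : ℕ) (J : Finset ℕ) (A : ℕ → ℕ → Prop) : Prop :=
  ∀ S ⊆ J, S.card ≤ ((Finset.range n).filter (fun i => ∃ j ∈ S, A j i)).card

/-- The invariant of the auction. The bidder `j` holds the object `i` if `own j = i + 1`, and holds
nothing if `own j = 0`; the object `i` has the price `q i`. -/
structure AuctionInv (n : ℕ) (J : Finset ℕ) (A : ℕ → ℕ → Prop) (own q : ℕ → ℕ) : Prop where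
  accepts : ∀ j ∈ J, ∀ i, own j = i + 1 → i < n ∧ A j i
  slack : ∀ j ∈ J, ∀ i, own j = i + 1 → ∀ i' < n, A j i' → q i ≤ q i' + 1
  inj : ∀ j ∈ J, ∀ j' ∈ J, own j = own j' → own j ≠ 0 → j = j'
  held : ∀ i < n, 0 < q i → ∃ j ∈ J, own j = i + 1
  price_le : ∀ i < n, q i ≤ n

section auction

variable {n : ℕ} {J : Finset ℕ} {A : ℕ → ℕ → Prop} {own q own' q' : ℕ → ℕ} {j₀ i₀ : ℕ}

/-- Otherwise, for every `l ≤ n`, the bidder `j₀` and the holders of objects of price at least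
`l + 1` accept only objects of price at least `l`, so that by Hall's condition there are more objects
of price at least `l` than of price at least `l + 1`; but there are only `n` objects. -/
theorem AuctionInv.exists_price_lt (h : AuctionInv n J A own q) (hall : HallCondition n J A)
    (hj : j₀ ∈ J) (h0 : own j₀ = 0) : ∃ i < n, A j₀ i ∧ q i < n := by
  classical
  by_contra! hcon
  set P : ℕ → Finset ℕ := fun l => (Finset.range n).filter (fun i => l ≤ q i) with hP
  have step : ∀ l ≤ n, (P (l + 1)).card + 1 ≤ (P l).card := by
    intro l hl
    -- the holders of objects of price at least `l + 1`
    set T := J.filter (fun j => ∃ i < n, own j = i + 1 ∧ l + 1 ≤ q i) with hT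
    have hjT : j₀ ∉ T := by
      simp [hT, h0]
    have h1 : (P (l + 1)).card ≤ T.card := by
      apply Finset.card_le_card_of_surjOn (fun j => own j - 1)
      intro i hi
      simp only [hP, Finset.coe_filter, Finset.mem_range, Set.mem_ofPred_eq] at hi
      obtain ⟨j, hjJ, hji⟩ := h.held i hi.1 (by omega)
      refine ⟨j, ?_, by simp [hji]⟩
      simp only [hT, Finset.coe_filter, Set.mem_ofPred_eq]
      exact ⟨hjJ, i, hi.1, hji, hi.2⟩
    have h2 := hall (insert j₀ T) (by
      intro j hjm
      rcases Finset.mem_insert.1 hjm with rfl | hjm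
      · exact hj
      · exact (Finset.mem_filter.1 hjm).1)
    rw [Finset.card_insert_of_notMem hjT] at h2
    have h3 : ((Finset.range n).filter (fun i => ∃ j ∈ insert j₀ T, A j i)) ⊆ P l := by
      intro i hi
      simp only [Finset.mem_filter, Finset.mem_range] at hi
      obtain ⟨hin, j, hjm, hji⟩ := hi
      simp only [hP, Finset.mem_filter, Finset.mem_range]
      refine ⟨hin, ?_⟩
      rcases Finset.mem_insert.1 hjm with rfl | hjm
      · exact hl.trans (hcon i hin hji)
      · obtain ⟨hjJ, i', hi', hj', hl'⟩ := Finset.mem_filter.1 hjm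
        have := h.slack j hjJ i' hj' i hin hji
        omega
    have h4 := Finset.card_le_card h3
    omega
  have key : ∀ l ≤ n + 1, (P l).card + l ≤ n := by
    intro l
    induction l with
    | zero =>
      intro _
      exact (Finset.card_filter_le _ _).trans (Finset.card_range n).le
    | succ l ih =>
      intro hl
      have := step l (by omega)
      have := ih (by omega)
      omega
  -- the level `n + 1` is within reach as `j₀` accepts only objects of price at least `n`
  have := key (n + 1) le_rfl
  omega

/-- An unassigned bidder takes an acceptable object of least price, and its price rises by one. -/
theorem AuctionInv.bid (h : AuctionInv n J A own q) (hall : HallCondition n J A)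
    (hj : j₀ ∈ J) (h0 : own j₀ = 0) (hi : i₀ < n) (hA : A j₀ i₀)
    (hmin : ∀ i < n, A j₀ i → q i₀ ≤ q i)
    (hown₀ : own' j₀ = i₀ + 1)
    (hown : ∀ j ∈ J, j ≠ j₀ → own' j = if own j = i₀ + 1 then 0 else own j)
    (hq₀ : q' i₀ = q i₀ + 1) (hq : ∀ i < n, i ≠ i₀ → q' i = q i) :
    AuctionInv n J A own' q' := by
  have hlt : q i₀ < n := by
    obtain ⟨i, hin, hAi, hqi⟩ := h.exists_price_lt hall hj h0
    exact (hmin i hin hAi).trans_lt hqi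
  have hle : ∀ i < n, q i ≤ q' i := by
    intro i hin
    by_cases hii : i = i₀
    · subst hii; omega
    · exact (hq i hin hii).ge
  have other : ∀ j ∈ J, j ≠ j₀ → ∀ i, own' j = i + 1 → own j = i + 1 ∧ i ≠ i₀ := by
    intro j hjJ hne i hji
    rw [hown j hjJ hne] at hji
    split_ifs at hji with hc
    exact ⟨hji, by rintro rfl; exact hc hji⟩
  refine ⟨?_, ?_, ?_, ?_, ?_⟩
  · intro j hjJ i hji
    by_cases hjj : j = j₀
    · subst hjj
      obtain rfl : i = i₀ := by omega
      exact ⟨hi, hA⟩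
    · exact h.accepts j hjJ i (other j hjJ hjj i hji).1
  · intro j hjJ i hji i' hi' hA'
    by_cases hjj : j = j₀
    · subst hjj
      obtain rfl : i = i₀ := by omega
      have := hmin i' hi' hA'
      have := hle i' hi'
      omega
    · obtain ⟨ho, hne⟩ := other j hjJ hjj i hji
      rw [hq i (h.accepts j hjJ i ho).1 hne]
      have := h.slack j hjJ i ho i' hi' hA'
      have := hle i' hi'
      omega
  · have aux : ∀ j ∈ J, own' j = i₀ + 1 → j = j₀ := by
      intro j hjJ hji
      by_contra hne
      exact (other j hjJ hne i₀ hji).2 rfl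
    intro j hjJ j' hjJ' heq hne
    obtain ⟨i, hji⟩ := Nat.exists_eq_succ_of_ne_zero hne
    by_cases hii : i = i₀
    · subst hii
      rw [aux j hjJ hji, aux j' hjJ' (heq ▸ hji)]
    · have hj1 : j ≠ j₀ := by rintro rfl; omega
      have hj2 : j' ≠ j₀ := by rintro rfl; omega
      have o1 := (other j hjJ hj1 i hji).1
      have o2 := (other j' hjJ' hj2 i (heq ▸ hji)).1
      exact h.inj j hjJ j' hjJ' (o1.trans o2.symm) (by omega)
  · intro i hin hpos
    by_cases hii : i = i₀
    · subst hii
      exact ⟨j₀, hj, hown₀⟩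
    · rw [hq i hin hii] at hpos
      obtain ⟨j, hjJ, hji⟩ := h.held i hin hpos
      have hj1 : j ≠ j₀ := by rintro rfl; omega
      refine ⟨j, hjJ, ?_⟩
      rw [hown j hjJ hj1, if_neg (by omega), hji]
  · intro i hin
    by_cases hii : i = i₀
    · subst hii; omega
    · rw [hq i hin hii]; exact h.price_le i hin

/-- At the start of the auction nothing is assigned and all prices are zero. -/
theorem AuctionInv.start (hown : ∀ j ∈ J, own j = 0) (hq : ∀ i < n, q i = 0) :
    AuctionInv n J A own q := by
  refine ⟨?_, ?_, ?_, ?_, ?_⟩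
  · intro j hj i h; rw [hown j hj] at h; omega
  · intro j hj i h; rw [hown j hj] at h; omega
  · intro j hj j' _ _ h; exact absurd (hown j hj) h
  · intro i hi h; rw [hq i hi] at h; omega
  · intro i hi; rw [hq i hi]; omega

theorem AuctionInv.sum_price_le (h : AuctionInv n J A own q) :
    ∑ i ∈ Finset.range n, q i ≤ n * n := by
  have := Finset.sum_le_card_nsmul (Finset.range n) q n
    (fun i hi => h.price_le i (Finset.mem_range.1 hi))
  simpa using this

theorem sum_price_succ (hi : i₀ < n) (hq₀ : q' i₀ = q i₀ + 1)
    (hq : ∀ i < n, i ≠ i₀ → q' i = q i) :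
    ∑ i ∈ Finset.range n, q' i = ∑ i ∈ Finset.range n, q i + 1 := by
  rw [← Finset.add_sum_erase _ q' (Finset.mem_range.2 hi),
    ← Finset.add_sum_erase _ q (Finset.mem_range.2 hi), hq₀]
  have : ∑ i ∈ (Finset.range n).erase i₀, q' i = ∑ i ∈ (Finset.range n).erase i₀, q i :=
    Finset.sum_congr rfl fun i hi =>
      hq i (Finset.mem_range.1 (Finset.mem_of_mem_erase hi)) (Finset.ne_of_mem_erase hi)
  omega

end auction

/-! ### Typical instances, and why matchings block by block give envy-freeness -/

/-- The chores of the block number `b`; all blocks but the last have `n` chores. -/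
def block (n m b : ℕ) : Finset ℕ := (Finset.Ico (b * n) (b * n + n)).filter (· < m)

/-- The number of nonempty blocks. -/
def numBlocks (n m : ℕ) : ℕ := ((Finset.range m).filter (fun b => b * n < m)).card

theorem mem_block {n m b j : ℕ} : j ∈ block n m b ↔ b * n ≤ j ∧ j < b * n + n ∧ j < m := by
  simp [block]

theorem card_block_le (n m b : ℕ) : (block n m b).card ≤ n := by
  refine (Finset.card_filter_le _ _).trans ?_
  simp

section deterministic

variable {n m : ℕ} (d : Fin n → Fin m → ℝ) (ρ S : ℝ)

/-- The bids that are allowed in the block starting at the chore `base`: the disutility of `j` for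
`i` has to be at most `ρ / n`, and, in the second block (`base = n`), no other agent `i'` may have
disutility at most `S / n` both for `j` and for the chore of the first block that `i` owns. -/
def Allowed (base : ℕ) (own : ℕ → ℕ) (j i : ℕ) : Prop :=
  n * readInput d i j ≤ ρ ∧ ∀ i' < n, ∀ c < n,
    ¬ (base = n ∧ own c = i + 1 ∧ i' ≠ i ∧ n * readInput d i' c ≤ S ∧ n * readInput d i' j ≤ S)

open Classical in
/-- Large sets of chores and agents have many pairs with disutility at most `ρ / n` between them. -/
def Expanding (J : Finset ℕ) : Prop :=
  ∀ X ⊆ J, ∀ T ⊆ Finset.range n, X.Nonempty → T.Nonempty → X.card + T.card = n + 1 →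
    2 * min X.card T.card <
      ((T ×ˢ X).filter (fun e => n * readInput d e.1 e.2 ≤ ρ)).card

/-- A pattern is a list of edges (row, column, flag) between the elements of `Fin k`. It occurs if
the elements of `Fin k` can be mapped to agents and to chores of the first two blocks, so that the
edges go to different entries of the matrix, which are at most `S / n` if the flag is `true` and at
most `ρ / n` if it is `false`. -/
def Occurs {k : ℕ} (L : List (Fin k × Fin k × Bool)) : Prop :=
  ∃ x : Fin k → ℕ, (∀ a, x a < 2 * n) ∧ (L.map (fun e => (x e.1, x e.2.1))).Nodup ∧
    ∀ e ∈ L, x e.1 < n ∧ x e.2.1 < m ∧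
      n * readInput d (x e.1) (x e.2.1) ≤ if e.2.2 then S else ρ

/-- Two cycles of length four with the chore `6` and no agent in common. -/
def patternDisjoint : List (Fin 7 × Fin 7 × Bool) :=
  [(0, 4, false), (1, 4, true), (0, 6, false), (1, 6, true),
    (2, 5, false), (3, 5, true), (2, 6, false), (3, 6, true)]

/-- Two cycles of length four with the chore `5` in common, in which two agents are blocked by the
same agent `2`. -/
def patternCommon : List (Fin 6 × Fin 6 × Bool) :=
  [(0, 3, false), (2, 3, true), (0, 5, false), (1, 5, false), (2, 5, true),
    (1, 4, false), (2, 4, true)]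

/-- Two cycles of length four with the chore `5` in common, in which the agent `0` is blocked by the
agent `1`, which is blocked by the agent `2`. -/
def patternChain : List (Fin 6 × Fin 6 × Bool) :=
  [(0, 3, false), (1, 3, true), (0, 5, false), (1, 5, false), (1, 4, false), (2, 4, true),
    (2, 5, true)]

/-- Two cycles of length four with the agent `0` and the chore `1` in common. -/
def patternAgent : List (Fin 6 × Fin 6 × Bool) :=
  [(0, 1, false), (2, 1, true), (3, 1, true), (0, 4, false), (2, 4, true), (0, 5, false),
    (3, 5, true)]

/-- Two cycles of length four with the agents `0` and `2` and the chore `1` in common. -/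
def patternAgents : List (Fin 5 × Fin 5 × Bool) :=
  [(0, 1, false), (2, 1, true), (0, 3, false), (0, 4, false), (2, 3, true), (2, 4, true)]

/-- The properties of an instance that make the algorithm succeed. -/
structure Typical : Prop where
  nonneg : ∀ i j, 0 ≤ d i j
  expanding : ∀ b, b * n < m → Expanding d ρ (block n m b)
  disjoint : ¬ Occurs d ρ S patternDisjoint
  common : ¬ Occurs d ρ S patternCommon
  chain : ¬ Occurs d ρ S patternChain
  agent : ¬ Occurs d ρ S patternAgent
  agents : ¬ Occurs d ρ S patternAgents

variable {d ρ S}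

open Classical in
/-- Deleting edges from an expanding graph, at most two at every vertex, preserves Hall's
condition. -/
theorem hallCondition_of_expanding {J : Finset ℕ} (hJ : J.card ≤ n) (hE : Expanding d ρ J)
    {A : ℕ → ℕ → Prop}
    (h1 : ∀ j ∈ J, ((Finset.range n).filter
      (fun i => n * readInput d i j ≤ ρ ∧ ¬ A j i)).card ≤ 2)
    (h2 : ∀ i < n, (J.filter (fun j => n * readInput d i j ≤ ρ ∧ ¬ A j i)).card ≤ 2) :
    HallCondition n J A := by
  intro X hX
  by_contra! hlt
  set N := (Finset.range n).filter (fun i => ∃ j ∈ X, A j i) with hN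
  have hXn : X.card ≤ n := (Finset.card_le_card hX).trans hJ
  have hc : (Finset.range n \ N).card = n - N.card := by
    rw [Finset.card_sdiff_of_subset (Finset.filter_subset _ _), Finset.card_range]
  obtain ⟨T, hT, hTc⟩ := Finset.exists_subset_card_eq
    (s := Finset.range n \ N) (n := n + 1 - X.card) (by omega)
  have hTn : T ⊆ Finset.range n := hT.trans Finset.sdiff_subset
  have hbad : ∀ i ∈ T, ∀ j ∈ X, ¬ A j i := by
    intro i hi j hj hA
    have := Finset.mem_sdiff.1 (hT hi)
    exact this.2 (Finset.mem_filter.2 ⟨this.1, j, hj, hA⟩)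
  have hlarge := hE X hX T hTn (Finset.card_pos.1 (by omega)) (Finset.card_pos.1 (by omega))
    (by omega)
  have hT2 : ((T ×ˢ X).filter (fun e => n * readInput d e.1 e.2 ≤ ρ)).card ≤ 2 * T.card := by
    rw [Finset.card_filter, Finset.sum_product, mul_comm, ← smul_eq_mul]
    refine Finset.sum_le_card_nsmul _ _ _ fun i hi => ?_
    rw [← Finset.card_filter]
    refine (Finset.card_le_card ?_).trans (h2 i (Finset.mem_range.1 (hTn hi)))
    intro j hj
    rw [Finset.mem_filter] at hj ⊢
    exact ⟨hX hj.1, hj.2, hbad i hi j hj.1⟩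
  have hX2 : ((T ×ˢ X).filter (fun e => n * readInput d e.1 e.2 ≤ ρ)).card ≤ 2 * X.card := by
    rw [Finset.card_filter, Finset.sum_product_right, mul_comm, ← smul_eq_mul]
    refine Finset.sum_le_card_nsmul _ _ _ fun j hj => ?_
    rw [← Finset.card_filter]
    refine (Finset.card_le_card ?_).trans (h1 j (hX hj))
    intro i hi
    rw [Finset.mem_filter] at hi ⊢
    exact ⟨hTn hi.1, hi.2, hbad i hi.1 j hj⟩
  rcases min_choice X.card T.card with h | h <;> omega

/-- A bid of acceptable disutility that is not allowed completes a cycle of length four. -/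
theorem exists_cycle_of_not_allowed {base : ℕ} {own : ℕ → ℕ} {i j : ℕ}
    (hs : n * readInput d i j ≤ ρ) (hA : ¬ Allowed d ρ S base own j i) :
    base = n ∧ ∃ i' < n, ∃ c < n, own c = i + 1 ∧ i' ≠ i ∧ n * readInput d i' c ≤ S ∧
      n * readInput d i' j ≤ S := by
  simp only [Allowed, hs, true_and, not_forall, not_not] at hA
  obtain ⟨i', hi', c, hc, h1, h2, h3, h4⟩ := hA
  exact ⟨h1, i', hi', c, hc, h2, h3, h4⟩

/-- At most one chore of the second block is forbidden to an agent: two such chores would give two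
cycles of length four through the agent and the chore of the first block that the agent owns. -/
theorem forbidden_agent {own : ℕ → ℕ} {i j₁ j₂ : ℕ} (hd : Typical d ρ S) (hnm : 2 * n ≤ m)
    (hown : ∀ c < n, ∀ i, own c = i + 1 → i < n ∧ n * readInput d i c ≤ ρ)
    (hinj : ∀ c < n, ∀ c' < n, own c = own c' → own c ≠ 0 → c = c')
    (hj₁ : j₁ ∈ block n m 1) (hj₂ : j₂ ∈ block n m 1)
    (hs₁ : n * readInput d i j₁ ≤ ρ) (hA₁ : ¬ Allowed d ρ S n own j₁ i)
    (hs₂ : n * readInput d i j₂ ≤ ρ) (hA₂ : ¬ Allowed d ρ S n own j₂ i) : j₁ = j₂ := by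
  by_contra hne
  obtain ⟨-, i₁, hi₁, c, hc, o₁, n₁, a₁, b₁⟩ := exists_cycle_of_not_allowed hs₁ hA₁
  obtain ⟨-, i₂, hi₂, c', hc', o₂, n₂, a₂, b₂⟩ := exists_cycle_of_not_allowed hs₂ hA₂
  obtain rfl : c = c' := hinj c hc c' hc' (o₁.trans o₂.symm) (by omega)
  obtain ⟨hin, hic⟩ := hown c hc i o₁
  rw [mem_block, one_mul] at hj₁ hj₂
  by_cases hii : i₁ = i₂
  · subst hii
    apply hd.agents
    refine ⟨![i, c, i₁, j₁, j₂], ?_, ?_, ?_⟩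
    · simp only [Fin.forall_fin_succ]; simp; omega
    · simp [patternAgents]; omega
    · simp [patternAgents, *]; omega
  · apply hd.agent
    refine ⟨![i, c, i₁, i₂, j₁, j₂], ?_, ?_, ?_⟩
    · simp only [Fin.forall_fin_succ]; simp; omega
    · simp [patternAgent]; omega
    · simp [patternAgent, *]; omega

/-- Two agents to which the chore `j` of the second block is forbidden are blocked by each other:
otherwise they lie on two different cycles of length four through `j`. -/
theorem forbidden_chore_pair {own : ℕ → ℕ} {j i₁ i₂ i₁' i₂' c₁ c₂ : ℕ} (hd : Typical d ρ S)
    (hnm : 2 * n ≤ m)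
    (hown : ∀ c < n, ∀ i, own c = i + 1 → i < n ∧ n * readInput d i c ≤ ρ)
    (hj : j ∈ block n m 1) (hne : i₁ ≠ i₂) (hnot : ¬ (i₁' = i₂ ∧ i₂' = i₁))
    (s₁ : n * readInput d i₁ j ≤ ρ) (s₂ : n * readInput d i₂ j ≤ ρ)
    (h₁ : i₁' < n) (h₂ : i₂' < n) (hc₁ : c₁ < n) (hc₂ : c₂ < n)
    (o₁ : own c₁ = i₁ + 1) (o₂ : own c₂ = i₂ + 1) (n₁ : i₁' ≠ i₁) (n₂ : i₂' ≠ i₂)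
    (a₁ : n * readInput d i₁' c₁ ≤ S) (b₁ : n * readInput d i₁' j ≤ S)
    (a₂ : n * readInput d i₂' c₂ ≤ S) (b₂ : n * readInput d i₂' j ≤ S) : False := by
  obtain ⟨k₁, t₁⟩ := hown c₁ hc₁ i₁ o₁
  obtain ⟨k₂, t₂⟩ := hown c₂ hc₂ i₂ o₂
  have hcc : c₁ ≠ c₂ := by rintro rfl; omega
  rw [mem_block, one_mul] at hj
  by_cases e₁ : i₁' = i₂'
  · subst e₁
    apply hd.common
    refine ⟨![i₁, i₂, i₁', c₁, c₂, j], ?_, ?_, ?_⟩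
    · simp only [Fin.forall_fin_succ]; simp; omega
    · simp [patternCommon]; omega
    · simp [patternCommon, *]; omega
  by_cases e₂ : i₁' = i₂
  · subst e₂
    apply hd.chain
    refine ⟨![i₁, i₁', i₂', c₁, c₂, j], ?_, ?_, ?_⟩
    · simp only [Fin.forall_fin_succ]; simp; omega
    · simp [patternChain]; omega
    · simp [patternChain, *]; omega
  by_cases e₃ : i₂' = i₁
  · subst e₃
    apply hd.chain
    refine ⟨![i₂, i₂', i₁', c₂, c₁, j], ?_, ?_, ?_⟩
    · simp only [Fin.forall_fin_succ]; simp; omega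
    · simp [patternChain]; omega
    · simp [patternChain, *]; omega
  apply hd.disjoint
  refine ⟨![i₁, i₁', i₂, i₂', c₁, c₂, j], ?_, ?_, ?_⟩
  · simp only [Fin.forall_fin_succ]; simp; omega
  · simp [patternDisjoint]; omega
  · simp [patternDisjoint, *]; omega

/-- At most two agents are forbidden the chore `j` of the second block, as no three agents can
pairwise block each other. -/
theorem forbidden_chore {own : ℕ → ℕ} {j i₁ i₂ i₃ : ℕ} (hd : Typical d ρ S) (hnm : 2 * n ≤ m)
    (hown : ∀ c < n, ∀ i, own c = i + 1 → i < n ∧ n * readInput d i c ≤ ρ)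
    (hj : j ∈ block n m 1) (h₁₂ : i₁ ≠ i₂) (h₁₃ : i₁ ≠ i₃) (h₂₃ : i₂ ≠ i₃)
    (s₁ : n * readInput d i₁ j ≤ ρ) (hA₁ : ¬ Allowed d ρ S n own j i₁)
    (s₂ : n * readInput d i₂ j ≤ ρ) (hA₂ : ¬ Allowed d ρ S n own j i₂)
    (s₃ : n * readInput d i₃ j ≤ ρ) (hA₃ : ¬ Allowed d ρ S n own j i₃) : False := by
  obtain ⟨-, i₁', k₁, c₁, l₁, o₁, n₁, a₁, b₁⟩ := exists_cycle_of_not_allowed s₁ hA₁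
  obtain ⟨-, i₂', k₂, c₂, l₂, o₂, n₂, a₂, b₂⟩ := exists_cycle_of_not_allowed s₂ hA₂
  obtain ⟨-, i₃', k₃, c₃, l₃, o₃, n₃, a₃, b₃⟩ := exists_cycle_of_not_allowed s₃ hA₃
  by_cases h : i₁' = i₂
  · exact forbidden_chore_pair hd hnm hown hj h₁₃ (by omega) s₁ s₃ k₁ k₃ l₁ l₃ o₁ o₃ n₁ n₃
      a₁ b₁ a₃ b₃
  · exact forbidden_chore_pair hd hnm hown hj h₁₂ (by omega) s₁ s₂ k₁ k₂ l₁ l₂ o₁ o₂ n₁ n₂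
      a₁ b₁ a₂ b₂

/-- In a typical instance, Hall's condition holds for the allowed bids of every block, provided that
the first block has been matched injectively along small entries when the second block is up. -/
theorem Typical.hallCondition {own : ℕ → ℕ} {b : ℕ} (hd : Typical d ρ S) (hnm : 2 * n ≤ m)
    (hn : 0 < n) (hb : b * n < m)
    (hown : b = 1 → ∀ c < n, ∀ i, own c = i + 1 → i < n ∧ n * readInput d i c ≤ ρ)
    (hinj : b = 1 → ∀ c < n, ∀ c' < n, own c = own c' → own c ≠ 0 → c = c') :
    HallCondition n (block n m b) (Allowed d ρ S (b * n) own) := by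
  classical
  have hb1 : ∀ j i, n * readInput d i j ≤ ρ → ¬ Allowed d ρ S (b * n) own j i → b = 1 := by
    intro j i hs hA
    have := (exists_cycle_of_not_allowed hs hA).1
    exact Nat.eq_of_mul_eq_mul_right hn (by omega)
  refine hallCondition_of_expanding (card_block_le n m b) (hd.expanding b hb) ?_ ?_
  · intro j hj
    by_contra! h
    obtain ⟨i₁, i₂, i₃, m₁, m₂, m₃, h₁₂, h₁₃, h₂₃⟩ := Finset.two_lt_card_iff.1 h
    simp only [Finset.mem_filter] at m₁ m₂ m₃
    obtain rfl := hb1 _ _ m₁.2.1 m₁.2.2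
    simp only [one_mul] at m₁ m₂ m₃
    exact forbidden_chore hd hnm (hown rfl) hj h₁₂ h₁₃ h₂₃ m₁.2.1 m₁.2.2 m₂.2.1 m₂.2.2
      m₃.2.1 m₃.2.2
  · intro i _
    by_contra! h
    obtain ⟨j₁, j₂, m₁, m₂, hne⟩ := Finset.one_lt_card_iff.1 (lt_trans one_lt_two h)
    simp only [Finset.mem_filter] at m₁ m₂
    obtain rfl := hb1 _ _ m₁.2.1 m₁.2.2
    simp only [one_mul] at m₁ m₂
    exact hne (forbidden_agent hd hnm (hown rfl) (hinj rfl) m₁.1 m₂.1 m₁.2.1 m₁.2.2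
      m₂.2.1 m₂.2.2)

/-- The number of chores in a bundle that contains at most one chore of every block. -/
theorem card_bundle_le {A : Fin m → Fin n} (hinj : ∀ b, ∀ j j' : Fin m, (j : ℕ) ∈ block n m b →
    (j' : ℕ) ∈ block n m b → A j = A j' → j = j') (i : Fin n) :
    (bundle A i).card ≤ numBlocks n m := by
  have hn : 0 < n := i.pos
  have hblock : ∀ j : Fin m, (j : ℕ) ∈ block n m ((j : ℕ) / n) := by
    intro j
    rw [mem_block]
    have := Nat.div_add_mod (j : ℕ) n
    have := Nat.mod_lt (j : ℕ) hn
    rw [mul_comm n] at *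
    exact ⟨by omega, by omega, j.2⟩
  refine Finset.card_le_card_of_injOn (fun j => (j : ℕ) / n) ?_ ?_
  · intro j _
    have h := mem_block.1 (hblock j)
    simp only [Finset.coe_filter, Finset.mem_range, Set.mem_ofPred_eq]
    exact ⟨(Nat.div_le_self _ _).trans_lt j.2, h.1.trans_lt h.2.2⟩
  · intro j hj j' hj' hjj
    have h1 : A j = i := by simpa [bundle] using hj
    have h2 : A j' = i := by simpa [bundle] using hj'
    have h3 := hblock j
    simp only at hjj
    rw [hjj] at h3
    exact hinj _ j j' h3 (hblock j') (h1.trans h2.symm)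

/-- In a full block, every agent gets a chore. -/
theorem exists_mem_block {A : Fin m → Fin n} {b : ℕ} (hb : b * n + n ≤ m)
    (hinj : ∀ j j' : Fin m, (j : ℕ) ∈ block n m b → (j' : ℕ) ∈ block n m b → A j = A j' → j = j')
    (i : Fin n) : ∃ j : Fin m, (j : ℕ) ∈ block n m b ∧ A j = i := by
  have hmem : ∀ k : Fin n, b * n + (k : ℕ) ∈ block n m b := by
    intro k
    rw [mem_block]
    omega
  have hf : Function.Injective (fun k : Fin n => A ⟨b * n + k, (mem_block.1 (hmem k)).2.2⟩) := by
    intro k k' h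
    have := hinj _ _ (hmem k) (hmem k') h
    simp only [Fin.mk.injEq] at this
    exact Fin.ext (by omega)
  obtain ⟨k, hk⟩ := (Finite.injective_iff_surjective.1 hf) i
  exact ⟨_, hmem k, hk⟩

theorem le_disutility {A : Fin m → Fin n} (hd : ∀ i j, 0 ≤ d i j) (i i' : Fin n) (j : Fin m)
    (hj : A j = i') : d i j ≤ disutility d i (bundle A i') :=
  Finset.single_le_sum (f := fun j => d i j) (fun j _ => hd i j) (by simp [bundle, hj])

/-- A bundle has at most one chore of every block, hence disutility at most `S / n` for its owner.
If the owner envied `i'`, the two chores of `i'` from the first two blocks would each have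
disutility at most `S / n`, which is forbidden. -/
theorem envyFree_of_blocks {A : Fin m → Fin n} (hd : ∀ i j, 0 ≤ d i j) (hnm : 2 * n ≤ m)
    (hρ : 0 ≤ ρ) (hS : numBlocks n m * ρ ≤ S)
    (hinj : ∀ b, ∀ j j' : Fin m, (j : ℕ) ∈ block n m b →
      (j' : ℕ) ∈ block n m b → A j = A j' → j = j')
    (hsmall : ∀ j, n * d (A j) j ≤ ρ)
    (hforb : ∀ j c : Fin m, (c : ℕ) ∈ block n m 0 → (j : ℕ) ∈ block n m 1 → A c = A j →
      ∀ i, i ≠ A j → ¬ (n * d i c ≤ S ∧ n * d i j ≤ S)) : EnvyFree d A := by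
  intro i i'
  by_contra! hlt
  have hne : i ≠ i' := by rintro rfl; exact lt_irrefl _ hlt
  have hown : n * disutility d i (bundle A i) ≤ S := by
    rw [disutility, Finset.mul_sum]
    calc ∑ j ∈ bundle A i, n * d i j ≤ (bundle A i).card • ρ := by
          refine Finset.sum_le_card_nsmul _ _ _ fun j hj => ?_
          have hj : A j = i := by simpa [bundle] using hj
          exact hj ▸ hsmall j
      _ ≤ numBlocks n m * ρ := by
          rw [nsmul_eq_mul]
          exact mul_le_mul_of_nonneg_right (by exact_mod_cast card_bundle_le hinj i) hρ
      _ ≤ S := hS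
  have hother : ∀ j, A j = i' → n * d i j ≤ S := fun j hj =>
    (mul_le_mul_of_nonneg_left ((le_disutility hd i i' j hj).trans hlt.le)
      (Nat.cast_nonneg n)).trans hown
  obtain ⟨c, hc, hci⟩ := exists_mem_block (b := 0) (by omega) (hinj 0) i'
  obtain ⟨j, hj, hji⟩ := exists_mem_block (b := 1) (by omega) (hinj 1) i'
  exact hforb j c hc hj (hci.trans hji.symm) i (hji ▸ hne) ⟨hother c hci, hother j hji⟩

end deterministic

/-! ### Probabilities of events about finitely many entries -/

theorem lintegral_pi_prod {ι : Type*} [Fintype ι] {X : ι → Type*} [∀ i, MeasurableSpace (X i)]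
    (μ : ∀ i, Measure (X i)) [∀ i, IsProbabilityMeasure (μ i)] (f : ∀ i, X i → ENNReal)
    (hf : ∀ i, Measurable (f i)) :
    ∫⁻ x, ∏ i, f i (x i) ∂Measure.pi μ = ∏ i, ∫⁻ y, f i y ∂μ i := by
  have h := ProbabilityTheory.lintegral_prod_eq_prod_lintegral_of_indepFun Finset.univ
    (fun (i : ι) (x : ∀ i, X i) => f i (x i))
    (ProbabilityTheory.iIndepFun_pi (μ := μ) (fun i => (hf i).aemeasurable))
    (fun i => (hf i).comp (measurable_pi_apply i))
  rw [h]
  exact Finset.prod_congr rfl fun i _ =>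
    (measurePreserving_eval μ i).lintegral_comp (hf i)

theorem prod_eq_prod_fin {M : Type*} [CommMonoid M] {n m : ℕ} (E : Finset (ℕ × ℕ))
    (hE : ∀ e ∈ E, e.1 < n ∧ e.2 < m) (H : ℕ → ℕ → M) :
    ∏ e ∈ E, H e.1 e.2 =
      ∏ i : Fin n, ∏ j : Fin m, if ((i : ℕ), (j : ℕ)) ∈ E then H i j else 1 := by
  rw [← Finset.prod_range (fun i => ∏ j : Fin m, if (i, (j : ℕ)) ∈ E then H i j else 1)]
  have h : ∀ i : ℕ, ∏ j : Fin m, (if (i, (j : ℕ)) ∈ E then H i j else 1) =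
      ∏ j ∈ Finset.range m, if (i, j) ∈ E then H i j else 1 :=
    fun i => (Finset.prod_range (fun j => if (i, j) ∈ E then H i j else 1)).symm
  rw [Finset.prod_congr rfl fun i _ => h i]
  rw [← Finset.prod_product (Finset.range n) (Finset.range m)
    (fun e => if e ∈ E then H e.1 e.2 else 1), ← Finset.prod_filter]
  refine Finset.prod_congr ?_ fun _ _ => rfl
  ext e
  simp only [Finset.mem_filter, Finset.mem_product, Finset.mem_range]
  exact ⟨fun h => ⟨hE e h, h⟩, fun h => h.2⟩

theorem readInput_fin {n m : ℕ} (d : Fin n → Fin m → ℝ) (i : Fin n) (j : Fin m) :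
    readInput d i j = d i j := by
  simp [readInput]

theorem lintegral_prod_entries (D : Measure ℝ) [IsProbabilityMeasure D] {n m : ℕ}
    (E : Finset (ℕ × ℕ)) (hE : ∀ e ∈ E, e.1 < n ∧ e.2 < m) (g : ℕ × ℕ → ℝ → ENNReal)
    (hg : ∀ e, Measurable (g e)) :
    ∫⁻ d, ∏ e ∈ E, g e (readInput d e.1 e.2) ∂instanceLaw D n m = ∏ e ∈ E, ∫⁻ y, g e y ∂D := by
  have h1 : ∀ d : Fin n → Fin m → ℝ, ∏ e ∈ E, g e (readInput d e.1 e.2) =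
      ∏ i : Fin n, ∏ j : Fin m, (if ((i : ℕ), (j : ℕ)) ∈ E then g (i, j) else fun _ => 1)
        (d i j) := by
    intro d
    rw [prod_eq_prod_fin E hE (fun i j => g (i, j) (readInput d i j))]
    refine Finset.prod_congr rfl fun i _ => Finset.prod_congr rfl fun j _ => ?_
    split_ifs
    · rw [readInput_fin]
    · rfl
  have hm : ∀ (i : Fin n) (j : Fin m),
      Measurable (if ((i : ℕ), (j : ℕ)) ∈ E then g (i, j) else fun _ => 1) := by
    intro i j
    split_ifs
    · exact hg _
    · exact measurable_const
  simp_rw [h1]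
  rw [instanceLaw, lintegral_pi_prod _ (fun (i : Fin n) (y : Fin m → ℝ) => ∏ j : Fin m,
    (if ((i : ℕ), (j : ℕ)) ∈ E then g (i, j) else fun _ => 1) (y j))
    (fun i => Finset.measurable_prod _ fun j _ => (hm i j).comp (measurable_pi_apply j)),
    prod_eq_prod_fin E hE (fun i j => ∫⁻ y, g (i, j) y ∂D)]
  refine Finset.prod_congr rfl fun i _ => ?_
  rw [lintegral_pi_prod _ _ (hm i)]
  refine Finset.prod_congr rfl fun j _ => ?_
  split_ifs <;> simp

/-- Markov's inequality for a product of functions of different entries, which are independent. -/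
theorem measure_le_prod_entries (D : Measure ℝ) [IsProbabilityMeasure D] {n m : ℕ} {ι : Type*}
    (s : Finset ι) (κ : ι → ℕ × ℕ) (hκ : Set.InjOn κ s)
    (hE : ∀ a ∈ s, (κ a).1 < n ∧ (κ a).2 < m) (g : ι → ℝ → ENNReal)
    (hg : ∀ a, Measurable (g a)) (c : ENNReal) (A : Set (Fin n → Fin m → ℝ))
    (hA : ∀ d ∈ A, 1 ≤ c * ∏ a ∈ s, g a (readInput d (κ a).1 (κ a).2)) :
    instanceLaw D n m A ≤ c * ∏ a ∈ s, ∫⁻ y, g a y ∂D := by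
  classical
  rcases s.eq_empty_or_nonempty with rfl | ⟨a₀, -⟩
  · have : IsProbabilityMeasure (instanceLaw D n m) := by unfold instanceLaw; infer_instance
    rcases A.eq_empty_or_nonempty with rfl | ⟨d, hd⟩
    · simp
    · refine prob_le_one.trans ?_
      simpa using hA d hd
  have : Nonempty ι := ⟨a₀⟩
  set h : ℕ × ℕ → ι := Function.invFunOn κ s with hh
  have hinv : ∀ a ∈ s, h (κ a) = a := fun a ha => hκ.leftInvOn_invFunOn ha
  have e1 : ∀ d : Fin n → Fin m → ℝ, ∏ a ∈ s, g a (readInput d (κ a).1 (κ a).2) =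
      ∏ e ∈ s.image κ, g (h e) (readInput d e.1 e.2) := by
    intro d
    rw [Finset.prod_image hκ]
    exact Finset.prod_congr rfl fun a ha => by rw [hinv a ha]
  have hE' : ∀ e ∈ s.image κ, e.1 < n ∧ e.2 < m := by
    intro e he
    obtain ⟨a, ha, rfl⟩ := Finset.mem_image.1 he
    exact hE a ha
  have e2 := lintegral_prod_entries D (s.image κ) hE' (fun e => g (h e)) (fun e => hg _)
  rw [Finset.prod_image hκ, Finset.prod_congr rfl (fun a ha => by rw [hinv a ha])] at e2
  have hmeas : Measurable fun d : Fin n → Fin m → ℝ =>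
      ∏ e ∈ s.image κ, g (h e) (readInput d e.1 e.2) := by
    refine Finset.measurable_prod _ fun e _ => (hg _).comp ?_
    unfold readInput
    split_ifs
    · fun_prop
    · exact measurable_const
  rw [← e2, ← lintegral_const_mul c hmeas]
  refine le_trans (measure_mono ?_) ((one_mul _).ge.trans
    (mul_meas_ge_le_lintegral (hmeas.const_mul c) 1))
  intro d hd
  have := hA d hd
  rwa [e1] at this

/-- All that is used about the distribution: its mass near `0` is linear up to constant factors. -/
theorem PDFBounded.bounds {D : Measure ℝ} (hD : PDFBounded D) :
    ∃ α β : ℝ, 0 < α ∧ 1 ≤ β ∧ D (Set.Iio 0) = 0 ∧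
      (∀ x : ℝ, 0 ≤ x → D (Set.Iic x) ≤ ENNReal.ofReal (β * x)) ∧
      ∀ x : ℝ, 0 ≤ x → x ≤ 1 → ENNReal.ofReal (α * x) ≤ D (Set.Iic x) := by
  obtain ⟨α, β, hα, hβ, f, hf, hfb, rfl⟩ := hD
  refine ⟨α, max β 1, hα, le_max_right _ _, ?_, ?_, ?_⟩
  · rw [withDensity_apply _ measurableSet_Iio, Measure.restrict_restrict measurableSet_Iio]
    have : Set.Iio (0 : ℝ) ∩ Set.Icc 0 1 = ∅ := by
      ext x; simp; intro h1 h2; linarith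
    simp [this]
  · intro x hx
    rw [withDensity_apply _ measurableSet_Iic, Measure.restrict_restrict measurableSet_Iic]
    calc ∫⁻ a in Set.Iic x ∩ Set.Icc 0 1, ENNReal.ofReal (f a)
        ≤ ∫⁻ a in Set.Iic x ∩ Set.Icc 0 1, ENNReal.ofReal (max β 1) := by
          refine setLIntegral_mono' (measurableSet_Iic.inter measurableSet_Icc) fun a ha => ?_
          exact ENNReal.ofReal_le_ofReal ((hfb a ha.2).2.trans (le_max_left _ _))
      _ ≤ ENNReal.ofReal (max β 1) * volume (Set.Icc 0 x) := by
          rw [setLIntegral_const]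
          gcongr
          intro a ha
          exact ⟨ha.2.1, ha.1⟩
      _ = ENNReal.ofReal (max β 1 * x) := by
          rw [Real.volume_Icc, sub_zero, ← ENNReal.ofReal_mul (by positivity)]
  · intro x hx hx1
    rw [withDensity_apply _ measurableSet_Iic, Measure.restrict_restrict measurableSet_Iic]
    calc ENNReal.ofReal (α * x) = ENNReal.ofReal α * volume (Set.Icc 0 x) := by
          rw [Real.volume_Icc, sub_zero, ← ENNReal.ofReal_mul hα.le]
      _ ≤ ∫⁻ a in Set.Iic x ∩ Set.Icc 0 1, ENNReal.ofReal α := by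
          rw [setLIntegral_const]
          gcongr
          intro a ha
          exact ⟨ha.2, ha.1, ha.2.trans hx1⟩
      _ ≤ _ := by
          refine setLIntegral_mono' (measurableSet_Iic.inter measurableSet_Icc) fun a ha => ?_
          exact ENNReal.ofReal_le_ofReal (hfb a ha.2).1

theorem setOf_mul_le_eq_Iic {n : ℕ} (hn : 0 < n) (t : ℝ) :
    {y : ℝ | n * y ≤ t} = Set.Iic (t / n) := by
  ext y
  have : (0 : ℝ) < n := by exact_mod_cast hn
  simp [le_div_iff₀ this, mul_comm]

theorem measure_neg_entry (D : Measure ℝ) [IsProbabilityMeasure D] (h0 : D (Set.Iio 0) = 0)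
    (n m : ℕ) : instanceLaw D n m {d | ¬ ∀ i j, 0 ≤ d i j} = 0 := by
  have : {d : Fin n → Fin m → ℝ | ¬ ∀ i j, 0 ≤ d i j} =
      ⋃ i : Fin n, ⋃ j : Fin m, {d | d i j < 0} := by
    ext d; simp
  rw [this, measure_iUnion_null_iff]
  intro i
  rw [measure_iUnion_null_iff]
  intro j
  have h1 := (measurePreserving_eval (fun _ : Fin m => D) j).measure_preimage
    (measurableSet_Iio (a := (0 : ℝ))).nullMeasurableSet
  have h2 := (measurePreserving_eval (fun _ : Fin n => Measure.pi fun _ : Fin m => D)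
    i).measure_preimage ((measurable_pi_apply j) (measurableSet_Iio (a := (0 : ℝ)))).nullMeasurableSet
  exact h2.trans (h1.trans h0)

/-- The union bound over all placements of a pattern. -/
theorem measure_occurs_le (D : Measure ℝ) [IsProbabilityMeasure D] (n m : ℕ) (ρ S : ℝ) {k : ℕ}
    (L : List (Fin k × Fin k × Bool)) :
    instanceLaw D n m {d | Occurs d ρ S L} ≤ (2 * n : ENNReal) ^ k *
      (L.map fun e => D {y : ℝ | n * y ≤ if e.2.2 then S else ρ}).prod := by
  classical
  set P := (L.map fun e => D {y : ℝ | n * y ≤ if e.2.2 then S else ρ}).prod with hP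
  let X : Finset (Fin k → ℕ) := Fintype.piFinset fun _ => Finset.range (2 * n)
  let F : (Fin k → ℕ) → Set (Fin n → Fin m → ℝ) := fun x =>
    {d | (L.map (fun e => (x e.1, x e.2.1))).Nodup ∧ ∀ e ∈ L, x e.1 < n ∧ x e.2.1 < m ∧
      n * readInput d (x e.1) (x e.2.1) ≤ if e.2.2 then S else ρ}
  have hsub : {d : Fin n → Fin m → ℝ | Occurs d ρ S L} ⊆ ⋃ x ∈ X, F x := by
    rintro d ⟨x, hx, hnd, hs⟩
    exact Set.mem_biUnion (x := x) (by simpa [X] using hx) ⟨hnd, hs⟩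
  have hF : ∀ x ∈ X, instanceLaw D n m (F x) ≤ P := by
    intro x _
    by_cases hne : (F x).Nonempty
    · obtain ⟨d₀, hnd, hs⟩ := hne
      have hLnd : L.Nodup := List.Nodup.of_map _ hnd
      have key := measure_le_prod_entries D L.toFinset (fun e => (x e.1, x e.2.1))
        (fun a ha b hb hab => List.inj_on_of_nodup_map hnd (by simpa using ha) (by simpa using hb) hab)
        (fun e he => ⟨(hs e (by simpa using he)).1, (hs e (by simpa using he)).2.1⟩)
        (fun e => {y : ℝ | n * y ≤ if e.2.2 then S else ρ}.indicator 1)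
        (fun e => measurable_one.indicator (measurableSet_le (by fun_prop) (by fun_prop)))
        1 (F x) (by
          intro d hd
          rw [one_mul, Finset.prod_eq_one]
          intro e he
          rw [Set.indicator_of_mem]
          · rfl
          · exact (hd.2 e (by simpa using he)).2.2)
      rw [one_mul] at key
      refine key.trans (le_of_eq ?_)
      rw [hP, ← List.prod_toFinset _ hLnd]
      refine Finset.prod_congr rfl fun e _ => ?_
      rw [lintegral_indicator_one (measurableSet_le (by fun_prop) (by fun_prop))]
    · rw [Set.not_nonempty_iff_eq_empty.1 hne]; simp
  calc instanceLaw D n m {d | Occurs d ρ S L} ≤ instanceLaw D n m (⋃ x ∈ X, F x) :=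
        measure_mono hsub
    _ ≤ ∑ x ∈ X, instanceLaw D n m (F x) := measure_biUnion_finset_le _ _
    _ ≤ X.card • P := Finset.sum_le_card_nsmul _ _ _ hF
    _ = (2 * n : ENNReal) ^ k * P := by
        simp [X, Fintype.card_piFinset]

section

variable (D : Measure ℝ) {n m : ℕ} {ρ S α β : ℝ}

theorem prod_entry_le (hn : 0 < n) (hρ : 0 ≤ ρ) (hS : 0 ≤ S) (hβ : 0 ≤ β)
    (hup : ∀ x : ℝ, 0 ≤ x → D (Set.Iic x) ≤ ENNReal.ofReal (β * x)) {k : ℕ}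
    (L : List (Fin k × Fin k × Bool)) :
    (L.map fun e => D {y : ℝ | n * y ≤ if e.2.2 then S else ρ}).prod ≤
      ENNReal.ofReal ((β / n) ^ L.length *
        (S ^ L.countP (fun e => e.2.2) * ρ ^ L.countP (fun e => !e.2.2))) := by
  induction L with
  | nil => simp
  | cons e L ih =>
    have hn' : (0 : ℝ) < n := by exact_mod_cast hn
    have he : ∀ t : ℝ, 0 ≤ t → D {y : ℝ | n * y ≤ t} ≤ ENNReal.ofReal (β / n * t) := by
      intro t ht
      rw [setOf_mul_le_eq_Iic hn]
      refine (hup _ (by positivity)).trans (le_of_eq ?_)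
      congr 1; ring
    rw [List.map_cons, List.prod_cons]
    rcases h : e.2.2 with _ | _
    · simp only [h, Bool.false_eq_true, if_false, List.length_cons, List.countP_cons, Bool.not_false,
        if_true, add_zero]
      refine (mul_le_mul' (he ρ hρ) ih).trans (le_of_eq ?_)
      rw [← ENNReal.ofReal_mul (by positivity)]
      congr 1; ring
    · simp only [h, Bool.false_eq_true, if_false, List.length_cons, List.countP_cons, Bool.not_true,
        if_true, add_zero]
      refine (mul_le_mul' (he S hS) ih).trans (le_of_eq ?_)
      rw [← ENNReal.ofReal_mul (by positivity)]
      congr 1; ring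

variable [IsProbabilityMeasure D]

/-- A pattern with more edges than vertices is unlikely. -/
theorem measure_pattern_le (m : ℕ) (hn : 0 < n) (hρ : 1 ≤ ρ) (hS : 1 ≤ S) (hβ : 1 ≤ β)
    (hup : ∀ x : ℝ, 0 ≤ x → D (Set.Iic x) ≤ ENNReal.ofReal (β * x)) {k : ℕ}
    (L : List (Fin k × Fin k × Bool)) (hk : k ≤ 7) (hL : L.length = k + 1)
    (ht : L.countP (fun e => e.2.2) ≤ 4) (hf : L.countP (fun e => !e.2.2) ≤ 4) :
    instanceLaw D n m {d | Occurs d ρ S L} ≤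
      ENNReal.ofReal (2 ^ 7 * β ^ 8 * (S ^ 4 * ρ ^ 4) / n) := by
  have hn' : (0 : ℝ) < n := by exact_mod_cast hn
  refine (measure_occurs_le D n m ρ S L).trans ?_
  have e0 : (2 * n : ENNReal) ^ k = ENNReal.ofReal ((2 * n) ^ k) := by
    rw [ENNReal.ofReal_pow (by positivity), ENNReal.ofReal_mul (by norm_num)]
    simp
  refine (mul_le_mul' e0.le (prod_entry_le D hn (by linarith) (by linarith) (by linarith)
    hup L)).trans ?_
  rw [← ENNReal.ofReal_mul (by positivity)]
  apply ENNReal.ofReal_le_ofReal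
  have e : (2 * (n : ℝ)) ^ k * ((β / n) ^ L.length *
        (S ^ L.countP (fun e => e.2.2) * ρ ^ L.countP (fun e => !e.2.2))) =
      2 ^ k * β ^ (k + 1) * (S ^ L.countP (fun e => e.2.2) * ρ ^ L.countP (fun e => !e.2.2)) / n := by
    rw [hL, mul_pow, div_pow, pow_succ (n : ℝ) k]
    field_simp
  rw [e]
  gcongr
  · norm_num
  · omega

open Classical in
/-- The lower tail of the number of small entries in a submatrix, by a bound on the expectation of
`(1 / 2) ^ N` for this number `N`. -/
theorem measure_few_small_le (hn : 0 < n) (hρ : 0 ≤ ρ) (hρn : ρ ≤ n)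
    (hlow : ∀ x : ℝ, 0 ≤ x → x ≤ 1 → ENNReal.ofReal (α * x) ≤ D (Set.Iic x))
    (T X : Finset ℕ) (hT : T ⊆ Finset.range n) (hX : X ⊆ Finset.range m) (u : ℕ) :
    instanceLaw D n m {d | ((T ×ˢ X).filter (fun e => n * readInput d e.1 e.2 ≤ ρ)).card ≤ 2 * u} ≤
      ENNReal.ofReal (4 ^ u * Real.exp (- (α * ρ / (2 * n))) ^ (T.card * X.card)) := by
  have hn' : (0 : ℝ) < n := by exact_mod_cast hn
  set B : Set ℝ := {y : ℝ | n * y ≤ ρ} with hB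
  have hBm : MeasurableSet B := measurableSet_le (by fun_prop) (by fun_prop)
  set g : ℝ → ENNReal := fun y => if y ∈ B then 2⁻¹ else 1 with hg
  have hgm : Measurable g := Measurable.ite hBm measurable_const measurable_const
  have hint : ∫⁻ y, g y ∂D ≤ ENNReal.ofReal (Real.exp (- (α * ρ / (2 * n)))) := by
    have h1 : ∫⁻ y, g y ∂D = 2⁻¹ * D B + D Bᶜ := by
      rw [← lintegral_add_compl g hBm]
      congr 1
      · rw [setLIntegral_congr_fun hBm (g := fun _ => 2⁻¹) (fun y hy => by simp [hg, hy]),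
          setLIntegral_const]
      · rw [setLIntegral_congr_fun hBm.compl (g := fun _ => 1)
          (fun y (hy : y ∉ B) => by simp [hg, hy]), setLIntegral_const, one_mul]
    have h2 : D B = ENNReal.ofReal (D.real B) := by simp [Measure.real]
    have h3 : D Bᶜ = ENNReal.ofReal (1 - D.real B) := by
      rw [← probReal_compl_eq_one_sub hBm]; simp [Measure.real]
    have h4 : α * (ρ / n) ≤ D.real B := by
      have := hlow (ρ / n) (by positivity) (by rw [div_le_one hn']; exact hρn)
      rw [← setOf_mul_le_eq_Iic hn, ← hB, h2] at this
      exact (ENNReal.ofReal_le_ofReal_iff measureReal_nonneg).1 this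
    have h5 : D.real B ≤ 1 := measureReal_le_one
    rw [h1, h2, h3, show (2⁻¹ : ENNReal) = ENNReal.ofReal 2⁻¹ by
      rw [ENNReal.ofReal_inv_of_pos (by norm_num)]; simp,
      ← ENNReal.ofReal_mul (by norm_num), ← ENNReal.ofReal_add (by positivity) (by linarith)]
    apply ENNReal.ofReal_le_ofReal
    have h6 := Real.add_one_le_exp (- (α * ρ / (2 * n)))
    have h7 : α * ρ / (2 * n) = α * (ρ / n) / 2 := by ring
    rw [h7] at h6 ⊢
    linarith
  have key := measure_le_prod_entries D (T ×ˢ X) id (Set.injOn_id _)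
    (fun e he => by
      have := Finset.mem_product.1 he
      exact ⟨Finset.mem_range.1 (hT this.1), Finset.mem_range.1 (hX this.2)⟩)
    (fun _ => g) (fun _ => hgm) (4 ^ u)
    {d | ((T ×ˢ X).filter (fun e => n * readInput d e.1 e.2 ≤ ρ)).card ≤ 2 * u} (by
      intro d hd
      have e1 : ∏ a ∈ T ×ˢ X, g (readInput d (id a).1 (id a).2) =
          2⁻¹ ^ ((T ×ˢ X).filter (fun e => n * readInput d e.1 e.2 ≤ ρ)).card := by
        rw [Finset.prod_ite]
        simp [hB]
      rw [e1]
      calc (1 : ENNReal) = 4 ^ u * 2⁻¹ ^ (2 * u) := by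
            rw [show (4 : ENNReal) = 2 ^ 2 by norm_num, ← pow_mul, ← mul_pow,
              ENNReal.mul_inv_cancel (by norm_num) (by norm_num), one_pow]
        _ ≤ _ := by
            gcongr 4 ^ u * ?_
            exact pow_le_pow_right_of_le_one' (by simp) hd)
  refine key.trans ?_
  rw [Finset.prod_const, Finset.card_product, ENNReal.ofReal_mul (by positivity),
    ENNReal.ofReal_pow (by norm_num), ENNReal.ofReal_pow (by positivity)]
  gcongr
  simp

/-- The union bound over all pairs of sets: if the smaller one has `u` elements, there are at most
`(n ^ 2) ^ u` pairs, each of which fails with probability at most `(4 * exp (-α * ρ / 4)) ^ u`. -/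
theorem measure_not_expanding_le (hn : 0 < n) (hρ : 0 ≤ ρ) (hρn : ρ ≤ n) (hα : 0 < α)
    (hlow : ∀ x : ℝ, 0 ≤ x → x ≤ 1 → ENNReal.ofReal (α * x) ≤ D (Set.Iic x))
    (hsmall : (n : ℝ) ^ 2 * (4 * Real.exp (- (α * ρ / 4))) ≤ 1)
    (J : Finset ℕ) (hJ : J ⊆ Finset.range m) (hJn : J.card ≤ n) :
    instanceLaw D n m {d | ¬ Expanding d ρ J} ≤
      ENNReal.ofReal (n * ((n : ℝ) ^ 2 * (4 * Real.exp (- (α * ρ / 4))))) := by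
  classical
  have hn' : (0 : ℝ) < n := by exact_mod_cast hn
  set z := Real.exp (- (α * ρ / 4)) with hz
  set y := Real.exp (- (α * ρ / (2 * n))) with hy
  let F : Finset ℕ → Finset ℕ → Set (Fin n → Fin m → ℝ) := fun X T =>
    {d | ((T ×ˢ X).filter (fun e => n * readInput d e.1 e.2 ≤ ρ)).card ≤ 2 * min X.card T.card}
  have hsub : {d : Fin n → Fin m → ℝ | ¬ Expanding d ρ J} ⊆
      ⋃ k ∈ Finset.Icc 1 n, ⋃ e ∈ Finset.powersetCard k J ×ˢ
        Finset.powersetCard (n + 1 - k) (Finset.range n), F e.1 e.2 := by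
    intro d hd
    simp only [Set.mem_ofPred_eq, Expanding] at hd
    push Not at hd
    obtain ⟨X, hX, T, hT, hX0, hT0, hc, hle⟩ := hd
    have h1 := Finset.card_pos.2 hX0
    have h2 := Finset.card_pos.2 hT0
    refine Set.mem_biUnion (x := X.card) (Finset.mem_coe.2 (Finset.mem_Icc.2 ⟨h1, by omega⟩)) ?_
    refine Set.mem_biUnion (x := (X, T)) ?_ hle
    rw [Finset.mem_coe, Finset.mem_product, Finset.mem_powersetCard, Finset.mem_powersetCard]
    exact ⟨⟨hX, rfl⟩, hT, by dsimp only; omega⟩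
  have hchoose : ∀ k l u : ℕ, k + l = n + 1 → min k l = u →
      J.card.choose k * n.choose l ≤ (n ^ 2) ^ u := by
    intro k l u hkl hu
    have h1 : J.card.choose k ≤ n.choose k := Nat.choose_le_choose k hJn
    have h2 : n.choose k ≤ n ^ u := by
      rcases le_total k l with h | h
      · rw [min_eq_left h] at hu
        exact hu ▸ Nat.choose_le_pow n k
      · rw [min_eq_right h] at hu
        rcases Nat.lt_or_ge n k with hk | hk
        · rw [Nat.choose_eq_zero_of_lt hk]; exact Nat.zero_le _
        rw [← Nat.choose_symm hk]
        exact (Nat.choose_le_pow n _).trans (Nat.pow_le_pow_right hn (by omega))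
    have h3 : n.choose l ≤ n ^ u := by
      rcases le_total k l with h | h
      · rw [min_eq_left h] at hu
        rcases Nat.lt_or_ge n l with hk | hk
        · rw [Nat.choose_eq_zero_of_lt hk]; exact Nat.zero_le _
        rw [← Nat.choose_symm hk]
        exact (Nat.choose_le_pow n _).trans (Nat.pow_le_pow_right hn (by omega))
      · rw [min_eq_right h] at hu
        exact hu ▸ Nat.choose_le_pow n l
    calc J.card.choose k * n.choose l ≤ n ^ u * n ^ u := Nat.mul_le_mul (h1.trans h2) h3
      _ = (n ^ 2) ^ u := by rw [← pow_mul, ← pow_add]; congr 1; omega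
  have hexp : ∀ k l u : ℕ, k + l = n + 1 → min k l = u → y ^ (l * k) ≤ z ^ u := by
    intro k l u hkl hu
    rw [hy, hz, ← Real.exp_nat_mul, ← Real.exp_nat_mul]
    apply Real.exp_le_exp.2
    have h1 : n * u ≤ 2 * (l * k) := by
      rcases le_total k l with h | h
      · rw [min_eq_left h] at hu
        subst hu
        nlinarith
      · rw [min_eq_right h] at hu
        subst hu
        nlinarith
    have h2 : (n : ℝ) * u ≤ 2 * (l * k : ℕ) := by exact_mod_cast h1
    have h3 : (u : ℝ) * (α * ρ / 4) ≤ (l * k : ℕ) * (α * ρ / (2 * n)) := by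
      have : (l * k : ℕ) * (α * ρ / (2 * n)) = (2 * (l * k : ℕ)) * (α * ρ / (4 * n)) := by
        field_simp; ring
      rw [this]
      calc (u : ℝ) * (α * ρ / 4) = (n * u) * (α * ρ / (4 * n)) := by field_simp
        _ ≤ _ := by gcongr
    linarith
  have hk : ∀ k ∈ Finset.Icc 1 n, instanceLaw D n m (⋃ e ∈ Finset.powersetCard k J ×ˢ
        Finset.powersetCard (n + 1 - k) (Finset.range n), F e.1 e.2) ≤
      ENNReal.ofReal ((n : ℝ) ^ 2 * (4 * z)) := by
    intro k hk
    rw [Finset.mem_Icc] at hk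
    set u := min k (n + 1 - k) with hu
    refine (measure_biUnion_finset_le _ _).trans ?_
    refine (Finset.sum_le_card_nsmul _ _ (ENNReal.ofReal (4 ^ u * z ^ u)) ?_).trans ?_
    · intro e he
      rw [Finset.mem_product, Finset.mem_powersetCard, Finset.mem_powersetCard] at he
      refine (measure_few_small_le D hn hρ hρn hlow e.2 e.1 he.2.1 (he.1.1.trans hJ) _).trans ?_
      rw [he.1.2, he.2.2]
      apply ENNReal.ofReal_le_ofReal
      gcongr
      exact hexp k (n + 1 - k) u (by omega) rfl
    · rw [Finset.card_product, Finset.card_powersetCard, Finset.card_powersetCard,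
        Finset.card_range, nsmul_eq_mul]
      have h1 := hchoose k (n + 1 - k) u (by omega) rfl
      calc ((J.card.choose k * n.choose (n + 1 - k) : ℕ) : ENNReal) * ENNReal.ofReal (4 ^ u * z ^ u)
          ≤ (((n ^ 2) ^ u : ℕ) : ENNReal) * ENNReal.ofReal (4 ^ u * z ^ u) := by gcongr
        _ = ENNReal.ofReal (((n : ℝ) ^ 2 * (4 * z)) ^ u) := by
            rw [← ENNReal.ofReal_natCast, ← ENNReal.ofReal_mul (by positivity)]
            congr 1
            push_cast
            rw [mul_pow, mul_pow]
        _ ≤ _ := by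
            apply ENNReal.ofReal_le_ofReal
            exact pow_le_of_le_one (by positivity) hsmall (by omega)
  calc _ ≤ _ := measure_mono hsub
    _ ≤ _ := measure_biUnion_finset_le _ _
    _ ≤ _ := Finset.sum_le_card_nsmul _ _ _ hk
    _ = _ := by
      rw [Nat.card_Icc, nsmul_eq_mul, ← ENNReal.ofReal_natCast, ← ENNReal.ofReal_mul (by positivity)]
      simp

end

/-! ### Instances are typical with high probability -/

theorem measure_not_typical_le (D : Measure ℝ) [IsProbabilityMeasure D] {n m : ℕ} {ρ S α β : ℝ}
    (hn : 0 < n) (hρ : 1 ≤ ρ) (hρn : ρ ≤ n) (hS : 1 ≤ S) (hα : 0 < α) (hβ : 1 ≤ β)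
    (h0 : D (Set.Iio 0) = 0)
    (hup : ∀ x : ℝ, 0 ≤ x → D (Set.Iic x) ≤ ENNReal.ofReal (β * x))
    (hlow : ∀ x : ℝ, 0 ≤ x → x ≤ 1 → ENNReal.ofReal (α * x) ≤ D (Set.Iic x))
    (hsmall : (n : ℝ) ^ 2 * (4 * Real.exp (- (α * ρ / 4))) ≤ 1) :
    instanceLaw D n m {d | ¬ Typical d ρ S} ≤
      ENNReal.ofReal (m * (n * ((n : ℝ) ^ 2 * (4 * Real.exp (- (α * ρ / 4)))))
        + 5 * (2 ^ 7 * β ^ 8 * (S ^ 4 * ρ ^ 4) / n)) := by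
  set a := n * ((n : ℝ) ^ 2 * (4 * Real.exp (- (α * ρ / 4)))) with ha
  set p := 2 ^ 7 * β ^ 8 * (S ^ 4 * ρ ^ 4) / (n : ℝ) with hp
  have ha0 : 0 ≤ a := by positivity
  have hp0 : 0 ≤ p := by positivity
  set N : Set (Fin n → Fin m → ℝ) := {d | ¬ ∀ i j, 0 ≤ d i j} with hN
  set E : Set (Fin n → Fin m → ℝ) := ⋃ b ∈ Finset.range m, {d | ¬ Expanding d ρ (block n m b)}
    with hE
  have hsub : {d : Fin n → Fin m → ℝ | ¬ Typical d ρ S} ⊆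
      N ∪ E ∪ {d | Occurs d ρ S patternDisjoint} ∪ {d | Occurs d ρ S patternCommon} ∪
        {d | Occurs d ρ S patternChain} ∪ {d | Occurs d ρ S patternAgent} ∪
        {d | Occurs d ρ S patternAgents} := by
    intro d hd
    by_contra hcon
    simp only [Set.mem_union, not_or] at hcon
    obtain ⟨⟨⟨⟨⟨⟨h1, h2⟩, h3⟩, h4⟩, h5⟩, h6⟩, h7⟩ := hcon
    refine hd ⟨not_not.1 h1, fun b hb => ?_, h3, h4, h5, h6, h7⟩
    by_contra hE'
    refine h2 (Set.mem_biUnion (x := b) ?_ hE')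
    simp only [Finset.coe_range, Set.mem_Iio]
    exact (Nat.le_mul_of_pos_right b hn).trans_lt hb
  have hEm : instanceLaw D n m E ≤ ENNReal.ofReal (m * a) := by
    refine (measure_biUnion_finset_le _ _).trans ?_
    refine (Finset.sum_le_card_nsmul _ _ (ENNReal.ofReal a) fun b _ => ?_).trans (le_of_eq ?_)
    · refine measure_not_expanding_le D hn (by linarith) hρn hα hlow hsmall _ ?_
        (card_block_le n m b)
      intro j hj
      exact Finset.mem_range.2 (mem_block.1 hj).2.2
    · rw [Finset.card_range, nsmul_eq_mul, ← ENNReal.ofReal_natCast,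
        ← ENNReal.ofReal_mul (by positivity)]
  have hpat : ∀ {k : ℕ} (L : List (Fin k × Fin k × Bool)), k ≤ 7 → L.length = k + 1 →
      L.countP (fun e => e.2.2) ≤ 4 → L.countP (fun e => !e.2.2) ≤ 4 →
      instanceLaw D n m {d | Occurs d ρ S L} ≤ ENNReal.ofReal p := fun L h1 h2 h3 h4 =>
    measure_pattern_le D m hn hρ hS hβ hup L h1 h2 h3 h4
  have e : ENNReal.ofReal (m * a + 5 * p) = 0 + ENNReal.ofReal (m * a) + ENNReal.ofReal p +
      ENNReal.ofReal p + ENNReal.ofReal p + ENNReal.ofReal p + ENNReal.ofReal p := by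
    rw [zero_add]
    repeat rw [← ENNReal.ofReal_add (by positivity) (by positivity)]
    congr 1; ring
  rw [e]
  refine (measure_mono hsub).trans ?_
  refine (measure_union_le _ _).trans (add_le_add ?_ (hpat patternAgents ?_ ?_ ?_ ?_))
  · refine (measure_union_le _ _).trans (add_le_add ?_ (hpat patternAgent ?_ ?_ ?_ ?_))
    · refine (measure_union_le _ _).trans (add_le_add ?_ (hpat patternChain ?_ ?_ ?_ ?_))
      · refine (measure_union_le _ _).trans (add_le_add ?_ (hpat patternCommon ?_ ?_ ?_ ?_))
        · refine (measure_union_le _ _).trans (add_le_add ?_ (hpat patternDisjoint ?_ ?_ ?_ ?_))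
          · exact (measure_union_le _ _).trans (add_le_add (measure_neg_entry D h0 n m).le hEm)
          all_goals decide
        all_goals decide
      all_goals decide
    all_goals decide
  all_goals decide

/-- The scaled threshold for the disutility of a chore for its owner, of the order `(log n) ^ 2`. -/
def scale (n : ℕ) : ℝ := (Nat.size n : ℝ) ^ 2

theorem log_le_size {n : ℕ} (hn : 0 < n) : Real.log n ≤ Nat.size n := by
  have h : (n : ℝ) < 2 ^ Nat.size n := by exact_mod_cast Nat.lt_size_self n
  have h1 := Real.log_lt_log (by exact_mod_cast hn) h
  rw [Real.log_pow] at h1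
  have h2 : Real.log 2 ≤ 1 := (Real.log_le_sub_one_of_pos two_pos).trans (by norm_num)
  nlinarith [Nat.cast_nonneg (α := ℝ) (Nat.size n)]

theorem size_le_log {n : ℕ} (hn : 3 ≤ n) : (Nat.size n : ℝ) ≤ 3 * Real.log n := by
  have hs : Nat.size n - 1 < Nat.size n := by
    have := Nat.size_pos.2 (show 0 < n by omega)
    omega
  have h : (2 : ℝ) ^ (Nat.size n - 1) ≤ n := by exact_mod_cast Nat.lt_size.1 hs
  have h1 := Real.log_le_log (by positivity) h
  rw [Real.log_pow, Nat.cast_sub (by omega)] at h1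
  have h2 := Real.log_two_gt_d9
  have h3 : 1 ≤ Real.log n := by
    rw [Real.le_log_iff_exp_le (by positivity)]
    have : (3 : ℝ) ≤ n := by exact_mod_cast hn
    linarith [Real.exp_one_lt_d9]
  have h4 : (1 : ℝ) ≤ Nat.size n := by
    have := Nat.size_pos.2 (show 0 < n by omega)
    exact_mod_cast this
  push_cast at h1
  nlinarith

theorem numBlocks_le {n m : ℕ} (hn : 0 < n) : (numBlocks n m : ℝ) ≤ m / n + 1 := by
  have h : numBlocks n m ≤ m / n + 1 := by
    unfold numBlocks
    refine (Finset.card_le_card (t := Finset.range (m / n + 1)) ?_).trans (by simp)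
    intro b hb
    simp only [Finset.mem_filter, Finset.mem_range] at hb ⊢
    exact Nat.lt_succ_of_le ((Nat.le_div_iff_mul_le hn).2 hb.2.le)
  calc (numBlocks n m : ℝ) ≤ (m / n + 1 : ℕ) := by exact_mod_cast h
    _ ≤ m / n + 1 := by push_cast; gcongr; exact Nat.cast_div_le

theorem tendsto_expanding_error {α : ℝ} (hα : 0 < α) :
    Tendsto (fun n : ℕ => 4 * ((n : ℝ) ^ 5 * Real.exp (- (α * scale n / 4)))) atTop (𝓝 0) := by
  have hlog : Tendsto (fun n : ℕ => Real.log n) atTop atTop :=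
    Real.tendsto_log_atTop.comp tendsto_natCast_atTop_atTop
  have h1 : Tendsto (fun u : ℝ => u * (α / 4 * u - 5)) atTop atTop := by
    refine tendsto_id.atTop_mul_atTop₀ ?_
    exact tendsto_atTop_add_const_right _ _ (tendsto_id.const_mul_atTop (by positivity))
  have h2 : Tendsto (fun n : ℕ => 4 * Real.exp (- (Real.log n * (α / 4 * Real.log n - 5))))
      atTop (𝓝 0) := by
    have := (Real.tendsto_exp_neg_atTop_nhds_zero.comp (h1.comp hlog)).const_mul 4
    simpa using this
  refine squeeze_zero' (Eventually.of_forall fun n => by positivity) ?_ h2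
  filter_upwards [eventually_ge_atTop 1] with n hn
  have hn' : (0 : ℝ) < n := by exact_mod_cast hn
  have h3 : (n : ℝ) ^ 5 = Real.exp (5 * Real.log n) := by
    rw [show (5 : ℝ) = (5 : ℕ) by norm_num, Real.exp_nat_mul, Real.exp_log hn']
  rw [h3, ← Real.exp_add]
  gcongr
  have h4 : Real.log n ^ 2 ≤ scale n :=
    pow_le_pow_left₀ (Real.log_natCast_nonneg n) (log_le_size hn) 2
  nlinarith

theorem tendsto_scale_pow (c : ℝ) (k : ℕ) {s : ℝ} (hs : 0 < s) :
    Tendsto (fun n : ℕ => c * (scale n ^ k / (n : ℝ) ^ s)) atTop (𝓝 0) := by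
  have h1 := (isLittleO_log_rpow_rpow_atTop (2 * k : ℝ) hs).tendsto_div_nhds_zero.comp
    (tendsto_natCast_atTop_atTop (R := ℝ))
  have h2 : Tendsto (fun n : ℕ => 9 ^ k * (Real.log n ^ (2 * k : ℝ) / (n : ℝ) ^ s)) atTop (𝓝 0) := by
    have := h1.const_mul (9 ^ k)
    simpa using this
  have h3 : Tendsto (fun n : ℕ => scale n ^ k / (n : ℝ) ^ s) atTop (𝓝 0) := by
    refine squeeze_zero' (Eventually.of_forall fun n => by unfold scale; positivity) ?_ h2
    filter_upwards [eventually_ge_atTop 3] with n hn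
    rw [← mul_div_assoc]
    gcongr
    rw [show (2 * k : ℝ) = ((2 * k : ℕ) : ℝ) by push_cast; ring, Real.rpow_natCast, pow_mul,
      ← mul_pow]
    unfold scale
    gcongr
    have := size_le_log hn
    have h0 : (0 : ℝ) ≤ Nat.size n := Nat.cast_nonneg _
    nlinarith
  simpa using h3.const_mul c

/-- In the range `2 * n ≤ m ≤ n ^ (8 / 7)`, instances are typical with high probability. -/
theorem eventually_typical (D : Measure ℝ) [IsProbabilityMeasure D] (hD : PDFBounded D) {ε : ℝ}
    (hε : 0 < ε) : ∀ᶠ n : ℕ in atTop, ∀ m : ℕ, 2 * n ≤ m → (m : ℝ) ≤ (n : ℝ) ^ ((8 : ℝ) / 7) →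
      instanceLaw D n m {d | ¬ Typical d (scale n) (numBlocks n m * scale n)} ≤
        ENNReal.ofReal ε := by
  obtain ⟨α, β, hα, hβ, h0, hup, hlow⟩ := hD.bounds
  have t1 := (tendsto_expanding_error hα).eventually (gt_mem_nhds (show 0 < min 1 (ε / 2) by
    positivity))
  have t2 := (tendsto_scale_pow (5 * (2 ^ 7 * β ^ 8 * 16)) 8
    (show (0 : ℝ) < 3 / 7 by norm_num)).eventually (gt_mem_nhds (show 0 < ε / 2 by positivity))
  have t3 := (tendsto_scale_pow 1 1 one_pos).eventually (gt_mem_nhds one_pos)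
  filter_upwards [t1, t2, t3, eventually_ge_atTop 1] with n h1 h2 h3 hn m hm1 hm2
  have hn' : (0 : ℝ) < n := by exact_mod_cast hn
  have hn1 : (1 : ℝ) ≤ n := by exact_mod_cast hn
  have hρ1 : 1 ≤ scale n := by
    have : 1 ≤ Nat.size n := Nat.size_pos.2 hn
    exact one_le_pow₀ (by exact_mod_cast this)
  have hρn : scale n ≤ n := by
    rw [one_mul, pow_one, Real.rpow_one, div_lt_one hn'] at h3
    exact h3.le
  have hB1 : (1 : ℝ) ≤ numBlocks n m := by
    have : 0 < numBlocks n m := by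
      unfold numBlocks
      exact Finset.card_pos.2 ⟨0, by simp; omega⟩
    exact_mod_cast this
  have hm1' : (2 : ℝ) * n ≤ m := by exact_mod_cast hm1
  have hB2 : (numBlocks n m : ℝ) ≤ 2 * (n : ℝ) ^ ((1 : ℝ) / 7) := by
    have e1 : (m : ℝ) / n ≤ (n : ℝ) ^ ((1 : ℝ) / 7) := by
      rw [div_le_iff₀ hn', ← Real.rpow_add_one hn'.ne']
      norm_num at hm2 ⊢
      exact hm2
    have e2 : 1 ≤ (m : ℝ) / n := by rw [le_div_iff₀ hn']; linarith
    linarith [numBlocks_le (n := n) (m := m) hn]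
  have hm3 : (m : ℝ) ≤ (n : ℝ) ^ 2 := by
    refine hm2.trans ?_
    rw [← Real.rpow_natCast]
    exact Real.rpow_le_rpow_of_exponent_le hn1 (by norm_num)
  set z := Real.exp (- (α * scale n / 4)) with hz
  have hz0 : 0 < z := Real.exp_pos _
  refine (measure_not_typical_le D hn hρ1 hρn (one_le_mul_of_one_le_of_one_le hB1 hρ1) hα hβ h0
    hup hlow ?_).trans ?_
  · have : (n : ℝ) ^ 2 * (4 * z) ≤ 4 * ((n : ℝ) ^ 5 * z) := by
      have : (n : ℝ) ^ 2 ≤ (n : ℝ) ^ 5 := pow_le_pow_right₀ hn1 (by norm_num)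
      nlinarith
    exact this.trans (h1.le.trans (min_le_left _ _))
  · apply ENNReal.ofReal_le_ofReal
    have e1 : (m : ℝ) * (n * ((n : ℝ) ^ 2 * (4 * z))) ≤ ε / 2 := by
      calc (m : ℝ) * (n * ((n : ℝ) ^ 2 * (4 * z))) ≤ (n : ℝ) ^ 2 * (n * ((n : ℝ) ^ 2 * (4 * z))) := by
            gcongr
        _ = 4 * ((n : ℝ) ^ 5 * z) := by ring
        _ ≤ ε / 2 := h1.le.trans (min_le_right _ _)
    have e2 : 5 * (2 ^ 7 * β ^ 8 * ((numBlocks n m * scale n) ^ 4 * scale n ^ 4) / n) ≤ ε / 2 := by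
      refine le_trans ?_ h2.le
      have e3 : (numBlocks n m : ℝ) ^ 4 ≤ 16 * (n : ℝ) ^ ((4 : ℝ) / 7) := by
        calc (numBlocks n m : ℝ) ^ 4 ≤ (2 * (n : ℝ) ^ ((1 : ℝ) / 7)) ^ 4 := by gcongr
          _ = 16 * (n : ℝ) ^ ((4 : ℝ) / 7) := by
            rw [mul_pow, ← Real.rpow_mul_natCast hn'.le]; norm_num
      have e4 : (n : ℝ) = (n : ℝ) ^ ((4 : ℝ) / 7) * (n : ℝ) ^ ((3 : ℝ) / 7) := by
        rw [← Real.rpow_add hn']; norm_num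
      have hpos := Real.rpow_pos_of_pos hn' ((4 : ℝ) / 7)
      have hpos' := Real.rpow_pos_of_pos hn' ((3 : ℝ) / 7)
      calc 5 * (2 ^ 7 * β ^ 8 * ((numBlocks n m * scale n) ^ 4 * scale n ^ 4) / n)
          = 5 * (2 ^ 7 * β ^ 8 * ((numBlocks n m : ℝ) ^ 4 * scale n ^ 8) / n) := by ring
        _ ≤ 5 * (2 ^ 7 * β ^ 8 * (16 * (n : ℝ) ^ ((4 : ℝ) / 7) * scale n ^ 8) / n) := by gcongr
        _ = 5 * (2 ^ 7 * β ^ 8 * 16) * (scale n ^ 8 / (n : ℝ) ^ ((3 : ℝ) / 7)) := by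
            have e5 : ∀ N x y : ℝ, 0 < x → 0 < y → N = x * y →
                5 * (2 ^ 7 * β ^ 8 * (16 * x * scale n ^ 8) / N) =
                  5 * (2 ^ 7 * β ^ 8 * 16) * (scale n ^ 8 / y) := by
              rintro N x y hx hy rfl
              field_simp
            exact e5 _ _ _ hpos hpos' e4
    linarith

/-! ### The program -/

/-- The natural number variable `a` is the entry `0` of the array number `a`. -/
def var (a : ℕ) : NExp := .arr a (.const 0)

/-- The real variable `a` is the entry `0` of the array number `a` of reals. -/
def rvar (a : ℕ) : RExp := .arr a (.const 0)

/-- Assigns the value of `v` to `var a`. -/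
def setVar (a : ℕ) (v : NExp) : FProg := .setNat a (.const 0) v

/-- Assigns the value of `v` to `rvar a`. -/
def setRVar (a : ℕ) (v : RExp) : FProg := .setReal a (.const 0) v

/-- The test for equality of natural numbers. -/
def Test.natEq (e₁ e₂ : NExp) : Test := .both (.natLe e₁ e₂) (.natLe e₂ e₁)

/-- Stores `n` times the disutility of agent `var a` for chore `var b` in `rvar r`. -/
def scaleEntry (a b r : ℕ) : FProg :=
  .seq (setRVar r (.sub .one .one))
    (.forTo 20 false (setRVar r (.add (rvar r) (.input (var a) (var b)))))

/-- Sets the flag `var 6` to `0` if the agent `var 12` and the chore `var 13` of the first block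
forbid the chore `var 4` to the agent `var 11`. -/
def checkConflict : FProg :=
  .seq (scaleEntry 12 13 3) (.seq (scaleEntry 12 4 4)
    (.ifThen (.both (.natEq (var 3) .agents) (.both (.natEq (.arr 1 (var 13)) (.add (var 11) (.const 1)))
      (.both (.neg (.natEq (var 12) (var 11)))
        (.both (.realLe (rvar 3) (rvar 1)) (.realLe (rvar 4) (rvar 1))))))
      (setVar 6 (.const 0))))

/-- Sets the flag `var 6` to `1` if and only if the chore `var 4` may bid for the agent `var 11`. -/
def checkAllowed : FProg :=
  .seq (setVar 6 (.const 1)) (.seq (scaleEntry 11 4 3)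
    (.seq (.ifThen (.neg (.realLe (rvar 3) (rvar 0))) (setVar 6 (.const 0)))
      (.forTo 12 false (.forTo 13 false checkConflict))))

/-- Stores in `var 5` the successor of an agent of least price for which the chore `var 4` may bid,
or `0` if there is none. -/
def chooseBest : FProg :=
  .seq (setVar 5 (.const 0)) (.forTo 11 false (.seq checkAllowed
    (.ifThen (.both (.natEq (var 6) (.const 1)) (.neg (.both (.natLe (.const 1) (var 5))
      (.natLe (.arr 2 (.add (var 3) (var 5)))
        (.arr 2 (.add (var 3) (.add (var 11) (.const 1))))))))
      (setVar 5 (.add (var 11) (.const 1))))))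

/-- Takes away the chore of the current block that is held by the agent encoded in `var 5`. -/
def release : FProg :=
  .forTo 14 false (.ifThen (.natEq (.arr 1 (.add (var 3) (var 14))) (var 5))
    (.setNat 1 (.add (var 3) (var 14)) (.const 0)))

/-- The chore `var 4` makes a bid. -/
def makeBid : FProg :=
  .seq chooseBest (.ifThen (.natLe (.const 1) (var 5)) (.seq release
    (.seq (.setNat 1 (var 4) (var 5)) (.setNat 2 (.add (var 3) (var 5))
      (.add (.arr 2 (.add (var 3) (var 5))) (.const 1))))))

/-- Every chore of the current block makes a bid if it is unassigned. -/
def runRound : FProg :=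
  .forTo 17 false (.seq (setVar 4 (.add (var 3) (var 17)))
    (.ifThen (.both (.natLe (.add (var 4) (.const 1)) .chores) (.natLe (.arr 1 (var 4)) (.const 0)))
      makeBid))

/-- `m * m` rounds, which are enough to assign all chores of a block in typical instances. -/
def runAuction : FProg := .forTo 15 true (.forTo 16 true runRound)

/-- Stores `scale n` in `rvar 0`. -/
def computeScale : FProg :=
  .seq (setVar 7 (.const 1)) (.forTo 10 false (.ifThen (.natLe (var 7) .agents)
    (.seq (setVar 7 (.add (var 7) (var 7)))
      (.seq (setRVar 0 (.add (rvar 0) (.add (rvar 2) (.add (rvar 2) .one))))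
        (setRVar 2 (.add (rvar 2) .one))))))

/-- Stores `numBlocks n m * scale n` in `rvar 1`. -/
def computeCap : FProg :=
  .seq (.forTo 10 true (.seq (.ifThen (.natLe (.add (var 3) (.const 1)) .chores)
      (setRVar 1 (.add (rvar 1) (rvar 0))))
    (setVar 3 (.add (var 3) .agents))))
  (setVar 3 (.const 0))

/-- The auctions of all blocks, one after the other. -/
def allBlocks : FProg := .forTo 10 true (.seq runAuction (setVar 3 (.add (var 3) .agents)))

/-- Copies the owners of all chores to the output array. -/
def writeOutput : FProg := .forTo 10 true (.setNat 0 (var 10) (.sub (.arr 1 (var 10)) (.const 1)))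

/-- The algorithm. The variables are: the threshold `rvar 0` for owned chores, the threshold `rvar 1`
for forbidden chores, the first chore `var 3` of the current block, and the chore `var 4` that bids.
The entry `j` of the array number `1` is the successor of the agent that owns the chore `j`, or `0`;
the entry `var 3 + (i + 1)` of the array number `2` is the price of the agent `i` in the current
block. -/
def algorithm : FProg :=
  .seq computeScale (.seq computeCap (.seq allBlocks writeOutput))

theorem algorithm_wellFormed : algorithm.wellFormed = true := by decide

/-! ### Its correctness -/

section

variable {n m : ℕ} (d : Fin n → Fin m → ℝ)

theorem natEq_holds (e₁ e₂ : NExp) (s : Memory) :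
    (Test.natEq e₁ e₂).Holds d s ↔ e₁.val n m s = e₂.val n m s := by
  simp only [Test.natEq, Test.Holds]
  omega

theorem scaleEntry_spec (s : Memory) {a b : ℕ} (r : ℕ) (ha : a ≠ 20) (hb : b ≠ 20) :
    ((scaleEntry a b r).run d s).real r 0 = n * readInput d (s.nat a 0) (s.nat b 0) := by
  have := FProg.run_forTo_induction d (x := 20) (c := false)
    (p := setRVar r (.add (rvar r) (.input (var a) (var b))))
    (s := (setRVar r (.sub .one .one)).run d s)
    (fun k s' => s'.real r 0 = k * readInput d (s.nat a 0) (s.nat b 0))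
    (by simp [setRVar, FProg.run, RExp.val, NExp.val])
    (by
      intro k _ s' _ hn _ hI
      have h1 := hn a (by simp [FProg.writesNat, setRVar, ha])
      have h2 := hn b (by simp [FProg.writesNat, setRVar, hb])
      simp only [setRVar, FProg.run, Memory.writeReal_nat] at h1 h2
      simp [setRVar, FProg.run, RExp.val, NExp.val, rvar, var, hI, h1, h2]
      ring)
  exact this

open Classical in
theorem checkConflict_spec (s : Memory) : (checkConflict.run d s).nat 6 0 =
    if s.nat 3 0 = n ∧ s.nat 1 (s.nat 13 0) = s.nat 11 0 + 1 ∧ s.nat 12 0 ≠ s.nat 11 0 ∧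
      n * readInput d (s.nat 12 0) (s.nat 13 0) ≤ s.real 1 0 ∧
      n * readInput d (s.nat 12 0) (s.nat 4 0) ≤ s.real 1 0 then 0 else s.nat 6 0 := by
  set s₁ := (scaleEntry 12 13 3).run d s with hs₁
  set s₂ := (scaleEntry 12 4 4).run d s₁ with hs₂
  have f₁ : ∀ a, a ≠ 20 → s₁.nat a = s.nat a := fun a ha =>
    FProg.run_nat_eq d _ _ (by simp [scaleEntry, setRVar, FProg.writesNat, ha])
  have f₂ : ∀ a, a ≠ 20 → s₂.nat a = s.nat a := fun a ha =>
    (FProg.run_nat_eq d _ _ (by simp [scaleEntry, setRVar, FProg.writesNat, ha])).trans (f₁ a ha)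
  have g₁ : s₂.real 1 = s.real 1 :=
    (FProg.run_real_eq d _ _ (by decide)).trans (FProg.run_real_eq d _ _ (by decide))
  have g₃ : s₂.real 3 0 = n * readInput d (s.nat 12 0) (s.nat 13 0) :=
    (congrFun (FProg.run_real_eq d _ _ (by decide)) 0).trans
      (scaleEntry_spec d s 3 (by decide) (by decide))
  have g₄ : s₂.real 4 0 = n * readInput d (s.nat 12 0) (s.nat 4 0) := by
    rw [← f₁ 12 (by decide), ← f₁ 4 (by decide)]
    exact scaleEntry_spec d s₁ 4 (by decide) (by decide)
  simp only [checkConflict, FProg.run, ← hs₁, ← hs₂, Test.Holds, natEq_holds, setVar, var, rvar,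
    NExp.val, RExp.val, f₂ 3 (by decide), f₂ 1 (by decide), f₂ 13 (by decide), f₂ 11 (by decide),
    f₂ 12 (by decide), g₁, g₃, g₄]
  split_ifs
  · simp
  · rw [f₂ 6 (by decide)]

theorem checkAllowed_spec (s : Memory) : (checkAllowed.run d s).nat 6 0 = 1 ↔
    Allowed d (s.real 0 0) (s.real 1 0) (s.nat 3 0) (s.nat 1) (s.nat 4 0) (s.nat 11 0) := by
  set C : ℕ → ℕ → Prop := fun i c => s.nat 3 0 = n ∧ s.nat 1 c = s.nat 11 0 + 1 ∧
    i ≠ s.nat 11 0 ∧ n * readInput d i c ≤ s.real 1 0 ∧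
      n * readInput d i (s.nat 4 0) ≤ s.real 1 0 with hC
  set s₁ := (setVar 6 (.const 1)).run d s with hs₁
  set s₂ := (scaleEntry 11 4 3).run d s₁ with hs₂
  set s₃ := (FProg.ifThen (.neg (.realLe (rvar 3) (rvar 0))) (setVar 6 (.const 0))).run d s₂ with hs₃
  have f₁ : ∀ a, a ≠ 6 → s₁.nat a = s.nat a := fun a ha =>
    FProg.run_nat_eq d _ _ (by simp [setVar, FProg.writesNat, ha])
  have f₂ : ∀ a, a ≠ 20 → s₂.nat a = s₁.nat a := fun a ha =>
    FProg.run_nat_eq d _ _ (by simp [scaleEntry, setRVar, FProg.writesNat, ha])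
  have f₃ : ∀ a, a ≠ 6 → a ≠ 20 → s₃.nat a = s.nat a := fun a h6 h20 =>
    (FProg.run_nat_eq d _ _ (by simp [setVar, FProg.writesNat, h6])).trans
      ((f₂ a h20).trans (f₁ a h6))
  have g₂ : ∀ a, a ≠ 3 → s₂.real a = s.real a := fun a ha =>
    (FProg.run_real_eq d _ _ (by simp [scaleEntry, setRVar, FProg.writesReal, ha])).trans
      (FProg.run_real_eq d _ _ rfl)
  have g₃ : ∀ a, a ≠ 3 → s₃.real a = s.real a := fun a ha =>
    (FProg.run_real_eq d _ _ rfl).trans (g₂ a ha)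
  have e₂ : s₂.real 3 0 = n * readInput d (s.nat 11 0) (s.nat 4 0) := by
    rw [← f₁ 11 (by decide), ← f₁ 4 (by decide)]
    exact scaleEntry_spec d s₁ 3 (by decide) (by decide)
  have e₃ : s₃.nat 6 0 = 1 ↔ n * readInput d (s.nat 11 0) (s.nat 4 0) ≤ s.real 0 0 := by
    have h6 : s₂.nat 6 0 = 1 := by
      rw [f₂ 6 (by decide), hs₁]
      simp [setVar, FProg.run, NExp.val]
    simp only [hs₃, FProg.run, Test.Holds, rvar, RExp.val, NExp.val, e₂, g₂ 0 (by decide), setVar]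
    split_ifs with h
    · simpa [h6] using h
    · simpa using h
  have key := FProg.run_forTo_induction d (x := 12) (c := false) (p := .forTo 13 false checkConflict)
    (s := s₃)
    (fun k s' => s'.nat 6 0 = 1 ↔ n * readInput d (s.nat 11 0) (s.nat 4 0) ≤ s.real 0 0 ∧
      ∀ i < k, ∀ c < n, ¬ C i c)
    (by simp [Memory.writeNat_nat_of_ne, e₃])
    (by
      intro k _ s' hk hn hr hI
      have inner := FProg.run_forTo_induction d (x := 13) (c := false) (p := checkConflict)
        (s := s')
        (fun l s'' => s''.nat 6 0 = 1 ↔ (n * readInput d (s.nat 11 0) (s.nat 4 0) ≤ s.real 0 0 ∧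
          ∀ i < k, ∀ c < n, ¬ C i c) ∧ ∀ c < l, ¬ C k c)
        (by simp [Memory.writeNat_nat_of_ne, hI])
        (by
          intro l _ s'' hl hn' hr' hI'
          have a1 : s''.nat 1 = s.nat 1 := (hn' 1 (by decide)).trans
            ((hn 1 (by decide)).trans (f₃ 1 (by decide) (by decide)))
          have a3 : s''.nat 3 = s.nat 3 := (hn' 3 (by decide)).trans
            ((hn 3 (by decide)).trans (f₃ 3 (by decide) (by decide)))
          have a4 : s''.nat 4 = s.nat 4 := (hn' 4 (by decide)).trans
            ((hn 4 (by decide)).trans (f₃ 4 (by decide) (by decide)))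
          have a11 : s''.nat 11 = s.nat 11 := (hn' 11 (by decide)).trans
            ((hn 11 (by decide)).trans (f₃ 11 (by decide) (by decide)))
          have a12 : s''.nat 12 0 = k := (congrFun (hn' 12 (by decide)) 0).trans hk
          have b1 : s''.real 1 = s.real 1 := (hr' 1 (by decide)).trans
            ((hr 1 (by decide)).trans (g₃ 1 (by decide)))
          rw [Memory.writeNat_nat_of_ne _ _ _ (by decide), checkConflict_spec, a1, a3, a4, a11, a12,
            b1, hl]
          have hsplit : (∀ c < l + 1, ¬ C k c) ↔ (∀ c < l, ¬ C k c) ∧ ¬ C k l := by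
            simp only [Nat.lt_succ_iff_lt_or_eq, or_imp, forall_and, forall_eq]
          rw [hsplit]
          split_ifs with h
          · have : C k l := h
            exact iff_of_false (by simp) fun h => h.2.2 this
          · have : ¬ C k l := h
            rw [hI']
            exact ⟨fun h => ⟨h.1, h.2, this⟩, fun h => ⟨h.1, h.2.1⟩⟩)
      rw [Memory.writeNat_nat_of_ne _ _ _ (by decide)]
      refine inner.trans ?_
      have hsplit : (∀ i < k + 1, ∀ c < n, ¬ C i c) ↔
          (∀ i < k, ∀ c < n, ¬ C i c) ∧ ∀ c < n, ¬ C k c := by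
        simp only [Nat.lt_succ_iff_lt_or_eq, or_imp, forall_and, forall_eq]
      rw [hsplit, and_assoc]
      rfl)
  exact key

end

section

variable {n m : ℕ} (d : Fin n → Fin m → ℝ)

theorem chooseBest_spec (s : Memory) {A : ℕ → Prop}
    (hA : ∀ i, A i ↔ Allowed d (s.real 0 0) (s.real 1 0) (s.nat 3 0) (s.nat 1) (s.nat 4 0) i) :
    ((chooseBest.run d s).nat 5 0 = 0 ∧ ∀ i < n, ¬ A i) ∨
    ∃ i < n, (chooseBest.run d s).nat 5 0 = i + 1 ∧ A i ∧
      ∀ i' < n, A i' → s.nat 2 (s.nat 3 0 + (i + 1)) ≤ s.nat 2 (s.nat 3 0 + (i' + 1)) := by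
  have key := FProg.run_forTo_induction d (x := 11) (c := false)
    (p := .seq checkAllowed (.ifThen (.both (.natEq (var 6) (.const 1))
      (.neg (.both (.natLe (.const 1) (var 5)) (.natLe (.arr 2 (.add (var 3) (var 5)))
        (.arr 2 (.add (var 3) (.add (var 11) (.const 1))))))))
      (setVar 5 (.add (var 11) (.const 1)))))
    (s := (setVar 5 (.const 0)).run d s)
    (fun k s' => (s'.nat 5 0 = 0 ∧ ∀ i < k, ¬ A i) ∨
      ∃ i < k, s'.nat 5 0 = i + 1 ∧ A i ∧
        ∀ i' < k, A i' → s.nat 2 (s.nat 3 0 + (i + 1)) ≤ s.nat 2 (s.nat 3 0 + (i' + 1)))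
    (by left; simp [setVar, FProg.run, NExp.val, Memory.writeNat_nat_of_ne])
    (by
      intro k _ s' hk hn hr hI
      have a : ∀ a, (FProg.writesNat (.seq (setVar 5 (.const 0)) (.forTo 11 false checkAllowed)) a)
          = false → (checkAllowed.run d s').nat a = s.nat a := by
        intro a ha
        simp only [FProg.writesNat, Bool.or_eq_false_iff, setVar, beq_eq_false_iff_ne] at ha
        rw [FProg.run_nat_eq d _ _ ha.2.2, hn a]
        · exact Memory.writeNat_nat_of_ne _ _ _ ha.1
        · simp [FProg.writesNat, setVar, ha]
      have a5 : (checkAllowed.run d s').nat 5 = s'.nat 5 := FProg.run_nat_eq d _ _ (by decide)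
      have a11 : (checkAllowed.run d s').nat 11 0 = k :=
        (congrFun (FProg.run_nat_eq d _ _ (by decide)) 0).trans hk
      have a6 : (checkAllowed.run d s').nat 6 0 = 1 ↔ A k := by
        rw [checkAllowed_spec, hA, hk]
        have b0 : s'.real 0 = s.real 0 := hr 0 (by decide)
        have b1 : s'.real 1 = s.real 1 := hr 1 (by decide)
        have c1 : s'.nat 1 = s.nat 1 :=
          (hn 1 (by decide)).trans (FProg.run_nat_eq d _ _ (by decide))
        have c3 : s'.nat 3 = s.nat 3 :=
          (hn 3 (by decide)).trans (FProg.run_nat_eq d _ _ (by decide))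
        have c4 : s'.nat 4 = s.nat 4 :=
          (hn 4 (by decide)).trans (FProg.run_nat_eq d _ _ (by decide))
        rw [b0, b1, c1, c3, c4]
      rw [Memory.writeNat_nat_of_ne _ _ _ (by decide)]
      set u := checkAllowed.run d s' with hu
      have hcond : (Test.both (.natEq (var 6) (.const 1)) (.neg (.both (.natLe (.const 1) (var 5))
          (.natLe (.arr 2 (.add (var 3) (var 5)))
            (.arr 2 (.add (var 3) (.add (var 11) (.const 1)))))))).Holds d u ↔
          A k ∧ ¬ (1 ≤ s'.nat 5 0 ∧
            s.nat 2 (s.nat 3 0 + s'.nat 5 0) ≤ s.nat 2 (s.nat 3 0 + (k + 1))) := by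
        simp only [Test.Holds, natEq_holds, var, NExp.val, a 2 (by decide), a 3 (by decide), a5,
          a11, a6]
      have hrun : ∀ p, (FProg.seq checkAllowed p).run d s' = p.run d u := fun _ => rfl
      rw [hrun]
      by_cases hAk : A k
      · by_cases hlt : 1 ≤ s'.nat 5 0 ∧
            s.nat 2 (s.nat 3 0 + s'.nat 5 0) ≤ s.nat 2 (s.nat 3 0 + (k + 1))
        · rw [FProg.run_ifThen_of_not_holds d (fun h => (hcond.1 h).2 hlt), a5]
          rcases hI with hI | ⟨i, hi, hI, hAi, hmin⟩
          · omega
          · refine Or.inr ⟨i, by omega, hI, hAi, fun i' hi' hA' => ?_⟩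
            rcases Nat.lt_succ_iff_lt_or_eq.1 hi' with h | rfl
            · exact hmin i' h hA'
            · rw [← hI]; exact hlt.2
        · rw [FProg.run_ifThen_of_holds d (hcond.2 ⟨hAk, hlt⟩)]
          refine Or.inr ⟨k, by omega, by simp [setVar, FProg.run, NExp.val, var, a11], hAk,
            fun i' hi' hA' => ?_⟩
          rcases Nat.lt_succ_iff_lt_or_eq.1 hi' with h | rfl
          · rcases hI with hI | ⟨i, hi, hI, hAi, hmin⟩
            · exact absurd hA' (hI.2 i' h)
            · have := hmin i' h hA'
              rw [hI] at hlt
              omega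
          · exact le_rfl
      · rw [FProg.run_ifThen_of_not_holds d (fun h => hAk (hcond.1 h).1), a5]
        rcases hI with hI | ⟨i, hi, hI, hAi, hmin⟩
        · refine Or.inl ⟨hI.1, fun i hi => ?_⟩
          rcases Nat.lt_succ_iff_lt_or_eq.1 hi with h | rfl
          · exact hI.2 i h
          · exact hAk
        · refine Or.inr ⟨i, by omega, hI, hAi, fun i' hi' hA' => ?_⟩
          rcases Nat.lt_succ_iff_lt_or_eq.1 hi' with h | rfl
          · exact hmin i' h hA'
          · exact absurd hA' hAk)
  exact key

theorem release_spec (s : Memory) (c : ℕ) : (release.run d s).nat 1 c =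
    if s.nat 3 0 ≤ c ∧ c < s.nat 3 0 + n ∧ s.nat 1 c = s.nat 5 0 then 0 else s.nat 1 c := by
  have key := FProg.run_forTo_induction d (x := 14) (c := false)
    (p := .ifThen (.natEq (.arr 1 (.add (var 3) (var 14))) (var 5))
      (.setNat 1 (.add (var 3) (var 14)) (.const 0)))
    (s := s)
    (fun k s' => ∀ c, s'.nat 1 c =
      if s.nat 3 0 ≤ c ∧ c < s.nat 3 0 + k ∧ s.nat 1 c = s.nat 5 0 then 0 else s.nat 1 c)
    (by
      intro c
      rw [if_neg (by omega), Memory.writeNat_nat_of_ne _ _ _ (by decide)])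
    (by
      intro k _ s' hk hn _ hI c
      rw [Memory.writeNat_nat_of_ne _ _ _ (by decide)]
      have hI' := hI (s.nat 3 0 + k)
      rw [if_neg (by omega)] at hI'
      have hcond : (Test.natEq (.arr 1 (.add (var 3) (var 14))) (var 5)).Holds d s' ↔
          s.nat 1 (s.nat 3 0 + k) = s.nat 5 0 := by
        simp only [natEq_holds, var, NExp.val, hn 3 (by decide), hn 5 (by decide), hk, hI']
      have hrest : c ≠ s.nat 3 0 + k ∨ ¬ s.nat 1 (s.nat 3 0 + k) = s.nat 5 0 → s'.nat 1 c =
          if s.nat 3 0 ≤ c ∧ c < s.nat 3 0 + (k + 1) ∧ s.nat 1 c = s.nat 5 0 then 0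
          else s.nat 1 c := by
        intro hc
        rw [hI c]
        by_cases hck : c = s.nat 3 0 + k
        · subst hck
          rw [if_neg (by omega), if_neg (by omega)]
        · exact if_congr (by omega) rfl rfl
      by_cases hh : s.nat 1 (s.nat 3 0 + k) = s.nat 5 0
      · rw [FProg.run_ifThen_of_holds d (hcond.2 hh)]
        have e : (FProg.setNat 1 (.add (var 3) (var 14)) (.const 0)).run d s' =
            s'.writeNat 1 (s.nat 3 0 + k) 0 := by
          simp only [FProg.run, var, NExp.val, hn 3 (by decide), hk]
        rw [e, Memory.writeNat_nat_self, Function.update_apply]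
        by_cases hc : c = s.nat 3 0 + k
        · subst hc
          rw [if_pos rfl, if_pos ⟨by omega, by omega, hh⟩]
        · rw [if_neg hc]
          exact hrest (Or.inl hc)
      · rw [FProg.run_ifThen_of_not_holds d (fun h => hh (hcond.1 h))]
        exact hrest (Or.inr hh))
  exact key c

/-- A bid goes to an allowed agent of least price, if there is one. -/
theorem makeBid_spec (s : Memory) {A : ℕ → Prop}
    (hA : ∀ i, A i ↔ Allowed d (s.real 0 0) (s.real 1 0) (s.nat 3 0) (s.nat 1) (s.nat 4 0) i)
    (hex : ∃ i < n, A i) :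
    ∃ i < n, A i ∧
      (∀ i' < n, A i' → s.nat 2 (s.nat 3 0 + (i + 1)) ≤ s.nat 2 (s.nat 3 0 + (i' + 1))) ∧
      (∀ c, (makeBid.run d s).nat 1 c = if c = s.nat 4 0 then i + 1 else
        if s.nat 3 0 ≤ c ∧ c < s.nat 3 0 + n ∧ s.nat 1 c = i + 1 then 0 else s.nat 1 c) ∧
      ∀ x, (makeBid.run d s).nat 2 x =
        if x = s.nat 3 0 + (i + 1) then s.nat 2 x + 1 else s.nat 2 x := by
  rcases chooseBest_spec d s hA with ⟨-, h⟩ | ⟨i, hi, h5, hAi, hmin⟩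
  · obtain ⟨i, hi, hAi⟩ := hex
    exact absurd hAi (h i hi)
  refine ⟨i, hi, hAi, hmin, ?_⟩
  set s₁ := chooseBest.run d s with hs₁
  set s₂ := release.run d s₁ with hs₂
  have a1 : s₁.nat 1 = s.nat 1 := FProg.run_nat_eq d _ _ (by decide)
  have a2 : s₁.nat 2 = s.nat 2 := FProg.run_nat_eq d _ _ (by decide)
  have a3 : s₁.nat 3 = s.nat 3 := FProg.run_nat_eq d _ _ (by decide)
  have a4 : s₁.nat 4 = s.nat 4 := FProg.run_nat_eq d _ _ (by decide)
  have b2 : s₂.nat 2 = s.nat 2 := (FProg.run_nat_eq d _ _ (by decide)).trans a2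
  have b3 : s₂.nat 3 = s.nat 3 := (FProg.run_nat_eq d _ _ (by decide)).trans a3
  have b4 : s₂.nat 4 = s.nat 4 := (FProg.run_nat_eq d _ _ (by decide)).trans a4
  have b5 : s₂.nat 5 0 = i + 1 := (congrFun (FProg.run_nat_eq d _ _ (by decide)) 0).trans h5
  have hb : makeBid.run d s = (s₂.writeNat 1 (s.nat 4 0) (i + 1)).writeNat 2 (s.nat 3 0 + (i + 1))
      (s.nat 2 (s.nat 3 0 + (i + 1)) + 1) := by
    simp [makeBid, FProg.run, ← hs₁, Test.Holds, NExp.val, var, h5, ← hs₂, b2, b3, b4, b5,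
      Memory.writeNat_nat_of_ne]
  rw [hb]
  refine ⟨fun c => ?_, fun x => ?_⟩
  · rw [Memory.writeNat_nat_of_ne _ _ _ (by decide), Memory.writeNat_nat_self,
      Function.update_apply, hs₂, release_spec, a1, a3, h5]
  · rw [Memory.writeNat_nat_self, Function.update_apply, Memory.writeNat_nat_of_ne _ _ _ (by decide),
      b2]
    split_ifs with h
    · rw [h]
    · rfl

theorem allowed_congr {ρ S : ℝ} {base : ℕ} {own own' : ℕ → ℕ}
    (h : base = n → ∀ c < n, own c = own' c) (j i : ℕ) :
    Allowed d ρ S base own j i ↔ Allowed d ρ S base own' j i := by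
  unfold Allowed
  refine and_congr_right fun _ => forall₂_congr fun i' _ => forall₂_congr fun c hc => ?_
  refine not_congr (and_congr_right fun hb => ?_)
  rw [h hb c hc]

/-- The invariant of the auction of the block number `b`; the auction starts with the memory `s`
and has now the memory `s'`. -/
structure BlockInv (b : ℕ) (A : ℕ → ℕ → Prop) (s s' : Memory) : Prop where
  inv : AuctionInv n (block n m b) A (s'.nat 1) (fun i => s'.nat 2 (b * n + (i + 1)))
  own_eq : ∀ c, c < b * n ∨ b * n + n ≤ c → s'.nat 1 c = s.nat 1 c
  price_eq : ∀ x, x ≤ b * n ∨ b * n + n < x → s'.nat 2 x = s.nat 2 x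

/-- The sum of the prices of all agents in the block number `b`. -/
def totalPrice (n b : ℕ) (s : Memory) : ℕ := ∑ i ∈ Finset.range n, s.nat 2 (b * n + (i + 1))

/-- All chores of the block number `b` are assigned. -/
def AllAssigned (n m b : ℕ) (s : Memory) : Prop := ∀ j ∈ block n m b, s.nat 1 j ≠ 0

variable {d} {b : ℕ} {A : ℕ → ℕ → Prop} {s s' : Memory} {ρ S : ℝ}

theorem BlockInv.bid (h : BlockInv (n := n) (m := m) b A s s')
    (hA : ∀ j i, A j i ↔ Allowed d ρ S (b * n) (s.nat 1) j i)
    (hall : HallCondition n (block n m b) A) (h3 : s'.nat 3 0 = b * n) (hρ : s'.real 0 0 = ρ)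
    (hS : s'.real 1 0 = S) (hj : s'.nat 4 0 ∈ block n m b) (h0 : s'.nat 1 (s'.nat 4 0) = 0) :
    BlockInv (n := n) (m := m) b A s (makeBid.run d s') ∧
      totalPrice n b (makeBid.run d s') = totalPrice n b s' + 1 := by
  have hA' : ∀ i, A (s'.nat 4 0) i ↔ Allowed d (s'.real 0 0) (s'.real 1 0) (s'.nat 3 0) (s'.nat 1)
      (s'.nat 4 0) i := by
    intro i
    rw [hA, hρ, hS, h3]
    refine allowed_congr d (fun hbn c hc => ?_) _ _
    exact (h.own_eq c (by left; omega)).symm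
  obtain ⟨i₁, hi₁, hA₁, -⟩ := h.inv.exists_price_lt hall hj h0
  obtain ⟨i, hi, hAi, hmin, hown, hprice⟩ := makeBid_spec d s' hA' ⟨i₁, hi₁, hA₁⟩
  rw [h3] at hmin hown hprice
  have hjb := mem_block.1 hj
  have q0 : (makeBid.run d s').nat 2 (b * n + (i + 1)) = s'.nat 2 (b * n + (i + 1)) + 1 := by
    rw [hprice, if_pos rfl]
  have q1 : ∀ i' < n, i' ≠ i →
      (makeBid.run d s').nat 2 (b * n + (i' + 1)) = s'.nat 2 (b * n + (i' + 1)) := by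
    intro i' _ hne
    rw [hprice, if_neg (by omega)]
  refine ⟨⟨?_, ?_, ?_⟩, ?_⟩
  · refine h.inv.bid hall hj h0 hi hAi hmin (by rw [hown, if_pos rfl]) ?_ q0 q1
    intro j hjJ hne
    rw [hown, if_neg hne]
    have := mem_block.1 hjJ
    simp only [this.1, this.2.1, true_and]
  · intro c hc
    rw [hown, if_neg (by omega), if_neg (by omega)]
    exact h.own_eq c hc
  · intro x hx
    rw [hprice, if_neg (by omega)]
    exact h.price_eq x hx
  · exact sum_price_succ (q := fun i => s'.nat 2 (b * n + (i + 1)))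
      (q' := fun i => (makeBid.run d s').nat 2 (b * n + (i + 1))) hi q0 q1

theorem BlockInv.writeNat (h : BlockInv (n := n) (m := m) b A s s') {a : ℕ} (k v : ℕ) (h1 : 1 ≠ a)
    (h2 : 2 ≠ a) : BlockInv (n := n) (m := m) b A s (s'.writeNat a k v) := by
  refine ⟨?_, ?_, ?_⟩
  all_goals simp only [Memory.writeNat_nat_of_ne _ _ _ h1, Memory.writeNat_nat_of_ne _ _ _ h2]
  exacts [h.inv, h.own_eq, h.price_eq]

theorem totalPrice_writeNat {a : ℕ} (k v : ℕ) (h2 : 2 ≠ a) :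
    totalPrice n b (s'.writeNat a k v) = totalPrice n b s' := by
  simp only [totalPrice, Memory.writeNat_nat_of_ne _ _ _ h2]

theorem allAssigned_writeNat {a : ℕ} (k v : ℕ) (h1 : 1 ≠ a) :
    AllAssigned n m b (s'.writeNat a k v) ↔ AllAssigned n m b s' := by
  simp only [AllAssigned, Memory.writeNat_nat_of_ne _ _ _ h1]

/-- After a round, all chores are assigned, or some chore was unassigned before the round and its bid
has raised the total price. -/
theorem BlockInv.round (h : BlockInv (n := n) (m := m) b A s s')
    (hA : ∀ j i, A j i ↔ Allowed d ρ S (b * n) (s.nat 1) j i)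
    (hall : HallCondition n (block n m b) A) (h3 : s'.nat 3 0 = b * n) (hρ : s'.real 0 0 = ρ)
    (hS : s'.real 1 0 = S) :
    BlockInv (n := n) (m := m) b A s (runRound.run d s') ∧
      (AllAssigned n m b (runRound.run d s') ∨
        ¬ AllAssigned n m b s' ∧ totalPrice n b s' + 1 ≤ totalPrice n b (runRound.run d s')) := by
  have key := FProg.run_forTo_induction d (x := 17) (c := false)
    (p := .seq (setVar 4 (.add (var 3) (var 17))) (.ifThen (.both
      (.natLe (.add (var 4) (.const 1)) .chores) (.natLe (.arr 1 (var 4)) (.const 0)))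
      makeBid))
    (s := s')
    (fun k s'' => BlockInv (n := n) (m := m) b A s s'' ∧
      ((s''.nat 1 = s'.nat 1 ∧ totalPrice n b s'' = totalPrice n b s' ∧
        ∀ j ∈ block n m b, j < b * n + k → s'.nat 1 j ≠ 0) ∨
      (¬ AllAssigned n m b s' ∧ totalPrice n b s' + 1 ≤ totalPrice n b s'')))
    (by
      refine ⟨h.writeNat _ _ (by decide) (by decide), Or.inl
        ⟨Memory.writeNat_nat_of_ne _ _ _ (by decide), totalPrice_writeNat _ _ (by decide), ?_⟩⟩
      intro j hj hjb
      have := mem_block.1 hj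
      omega)
    (by
      intro k hk s'' hk' hn' hr' ⟨hI, hI'⟩
      have hk : k < n := hk
      set t := (setVar 4 (.add (var 3) (var 17))).run d s'' with ht
      have e3 : s''.nat 3 0 = b * n := (congrFun (hn' 3 (by decide)) 0).trans h3
      have ht' : t = s''.writeNat 4 0 (b * n + k) := by
        simp [ht, setVar, FProg.run, NExp.val, var, e3, hk']
      have t4 : t.nat 4 0 = b * n + k := by simp [ht']
      have t3 : t.nat 3 0 = b * n := by
        rw [ht', Memory.writeNat_nat_of_ne _ _ _ (by decide), e3]
      have t1 : t.nat 1 = s''.nat 1 := by rw [ht', Memory.writeNat_nat_of_ne _ _ _ (by decide)]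
      have tI : BlockInv (n := n) (m := m) b A s t := ht' ▸ hI.writeNat _ _ (by decide) (by decide)
      have tp : totalPrice n b t = totalPrice n b s'' := by
        rw [ht']; exact totalPrice_writeNat _ _ (by decide)
      have tρ : t.real 0 0 = ρ := by
        rw [ht', Memory.writeNat_real, hr' 0 (by decide), hρ]
      have tS : t.real 1 0 = S := by
        rw [ht', Memory.writeNat_real, hr' 1 (by decide), hS]
      rw [totalPrice_writeNat _ _ (by decide), Memory.writeNat_nat_of_ne _ _ _ (by decide)]
      suffices hs : ∀ u, u = (FProg.ifThen (.both (.natLe (.add (var 4) (.const 1)) .chores)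
          (.natLe (.arr 1 (var 4)) (.const 0))) makeBid).run d t →
          BlockInv (n := n) (m := m) b A s u ∧
          ((u.nat 1 = s'.nat 1 ∧ totalPrice n b u = totalPrice n b s' ∧
            ∀ j ∈ block n m b, j < b * n + (k + 1) → s'.nat 1 j ≠ 0) ∨
          (¬ AllAssigned n m b s' ∧ totalPrice n b s' + 1 ≤ totalPrice n b u)) by
        obtain ⟨h1, h2⟩ := hs _ rfl
        exact ⟨h1.writeNat _ _ (by decide) (by decide), h2⟩
      rintro u rfl
      simp only [FProg.run, Test.Holds, var, NExp.val, t4, t1]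
      by_cases hc : b * n + k + 1 ≤ m ∧ s''.nat 1 (b * n + k) ≤ 0
      · rw [if_pos hc]
        have hj : b * n + k ∈ block n m b := mem_block.2 (by omega)
        obtain ⟨k1, k2⟩ := tI.bid hA hall t3 tρ tS (t4.symm ▸ hj)
          (by rw [t4, t1]; omega)
        refine ⟨k1, Or.inr ?_⟩
        rw [k2, tp]
        rcases hI' with hI' | hI'
        · refine ⟨fun hall' => ?_, by omega⟩
          refine hall' _ hj ?_
          rw [← hI'.1]; omega
        · exact ⟨hI'.1, by omega⟩
      · rw [if_neg hc]
        refine ⟨tI, hI'.imp (fun hI' => ?_) (fun hI' => ?_)⟩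
        · refine ⟨t1.trans hI'.1, tp.trans hI'.2.1, fun j hj hjb => ?_⟩
          have := mem_block.1 hj
          by_cases hjk : j < b * n + k
          · exact hI'.2.2 j hj hjk
          · obtain rfl : j = b * n + k := by omega
            rw [← hI'.1]
            omega
        · exact ⟨hI'.1, by omega⟩)
  refine ⟨key.1, key.2.imp (fun hk => ?_) id⟩
  intro j hj
  have := hk.2.2 j hj (mem_block.1 hj).2.1
  rw [← hk.1] at this
  exact this

/-- The auction of a block that satisfies Hall's condition assigns all its chores: the total price is
at most `n * n`, and every round with unassigned chores makes it grow. -/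
theorem BlockInv.auction (h : BlockInv (n := n) (m := m) b A s s)
    (hA : ∀ j i, A j i ↔ Allowed d ρ S (b * n) (s.nat 1) j i) (hnm : n < m)
    (hall : HallCondition n (block n m b) A) (h3 : s.nat 3 0 = b * n) (hρ : s.real 0 0 = ρ)
    (hS : s.real 1 0 = S) :
    BlockInv (n := n) (m := m) b A s (runAuction.run d s) ∧
      AllAssigned n m b (runAuction.run d s) := by
  have key := FProg.run_forTo_induction d (x := 15) (c := true) (p := .forTo 16 true
      runRound)
    (s := s)
    (fun k s' => BlockInv (n := n) (m := m) b A s s' ∧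
      (AllAssigned n m b s' ∨ k * m ≤ totalPrice n b s'))
    ⟨h.writeNat _ _ (by decide) (by decide), Or.inr (by simp)⟩
    (by
      intro k _ s' _ hn' hr' ⟨hI, hI'⟩
      have inner := FProg.run_forTo_induction d (x := 16) (c := true) (p := runRound)
        (s := s')
        (fun l s'' => BlockInv (n := n) (m := m) b A s s'' ∧
          (AllAssigned n m b s'' ∨ k * m + l ≤ totalPrice n b s''))
        ⟨hI.writeNat _ _ (by decide) (by decide), hI'.imp
          (allAssigned_writeNat _ _ (by decide)).2
          (fun h => by rw [totalPrice_writeNat _ _ (by decide)]; exact h)⟩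
        (by
          intro l _ s'' _ hn'' hr'' ⟨hJ, hJ'⟩
          have e3 : s''.nat 3 0 = b * n := by
            rw [hn'' 3 (by decide), hn' 3 (by decide), h3]
          have eρ : s''.real 0 0 = ρ := by rw [hr'' 0 (by decide), hr' 0 (by decide), hρ]
          have eS : s''.real 1 0 = S := by rw [hr'' 1 (by decide), hr' 1 (by decide), hS]
          obtain ⟨r1, r2⟩ := hJ.round hA hall e3 eρ eS
          refine ⟨r1.writeNat _ _ (by decide) (by decide), ?_⟩
          rw [allAssigned_writeNat _ _ (by decide), totalPrice_writeNat _ _ (by decide)]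
          refine r2.imp id fun r2 => ?_
          have := hJ'.resolve_left r2.1
          omega)
      refine ⟨inner.1.writeNat _ _ (by decide) (by decide), ?_⟩
      rw [allAssigned_writeNat _ _ (by decide), totalPrice_writeNat _ _ (by decide)]
      refine inner.2.imp id fun h => ?_
      rw [Nat.succ_mul]
      exact h)
  refine ⟨key.1, key.2.resolve_right fun hk => ?_⟩
  have h1 : totalPrice n b (runAuction.run d s) ≤ n * n := key.1.inv.sum_price_le
  have h2 : m * m ≤ n * n := le_trans hk h1
  nlinarith

end

section

variable {n m : ℕ} (d : Fin n → Fin m → ℝ)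

theorem computeScale_spec : (computeScale.run d Memory.init).real 0 0 = scale n := by
  have key := FProg.run_forTo_induction d (x := 10) (c := false)
    (p := .ifThen (.natLe (var 7) .agents)
      (.seq (setVar 7 (.add (var 7) (var 7)))
        (.seq (setRVar 0 (.add (rvar 0) (.add (rvar 2) (.add (rvar 2) .one))))
          (setRVar 2 (.add (rvar 2) .one)))))
    (s := (setVar 7 (.const 1)).run d Memory.init)
    (fun k s' => ∃ l : ℕ, s'.nat 7 0 = 2 ^ l ∧ s'.real 2 0 = l ∧ s'.real 0 0 = (l : ℝ) ^ 2 ∧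
      (l = k ∨ n < 2 ^ l) ∧ l ≤ Nat.size n)
    ⟨0, by simp [setVar, FProg.run, NExp.val, Memory.writeNat_nat_of_ne],
      by simp [setVar, FProg.run, Memory.init], by simp [setVar, FProg.run, Memory.init],
      Or.inl rfl, Nat.zero_le _⟩
    (by
      rintro k _ s' hk - - ⟨l, h1, h2, h3, h4, h5⟩
      rw [Memory.writeNat_nat_of_ne _ _ _ (by decide), Memory.writeNat_real]
      by_cases hl : 2 ^ l ≤ n
      · rw [FProg.run_ifThen_of_holds d
          (by simpa only [Test.Holds, var, NExp.val, h1] using hl)]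
        refine ⟨l + 1, ?_, ?_, ?_, ?_, Nat.lt_size.2 hl⟩
        · simp [setVar, setRVar, FProg.run, NExp.val, var, h1]
          ring
        · simp [setVar, setRVar, FProg.run, NExp.val, RExp.val, rvar,
            Memory.writeReal_real_of_ne, h2]
        · simp [setVar, setRVar, FProg.run, NExp.val, RExp.val, rvar,
            Memory.writeReal_real_of_ne, h2, h3]
          ring
        · left; omega
      · rw [FProg.run_ifThen_of_not_holds d
          (by simpa only [Test.Holds, var, NExp.val, h1] using hl)]
        exact ⟨l, h1, h2, h3, Or.inr (by omega), h5⟩)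
  obtain ⟨l, -, -, h3, h4, h5⟩ := key
  have hl : n < 2 ^ l := by
    rcases h4 with h4 | h4
    · have : l = n := h4
      rw [this]; exact Nat.lt_two_pow_self
    · exact h4
  have : l = Nat.size n := le_antisymm h5 (Nat.size_le.2 hl)
  rw [this] at h3
  exact h3

theorem computeCap_spec (s : Memory) (h3 : s.nat 3 0 = 0) (hS : s.real 1 0 = 0) :
    (computeCap.run d s).real 1 0 = numBlocks n m * s.real 0 0 := by
  have key := FProg.run_forTo_induction d (x := 10) (c := true)
    (p := .seq (.ifThen (.natLe (.add (var 3) (.const 1)) .chores)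
      (setRVar 1 (.add (rvar 1) (rvar 0)))) (setVar 3 (.add (var 3) .agents)))
    (s := s)
    (fun k s' => s'.nat 3 0 = k * n ∧
      s'.real 1 0 = ((Finset.range k).filter (fun b => b * n < m)).card * s.real 0 0)
    (by simp [Memory.writeNat_nat_of_ne, h3, hS])
    (by
      rintro k _ s' hk - hr ⟨h1, h2⟩
      have hr0 : s'.real 0 = s.real 0 := hr 0 (by decide)
      have hrun : ∀ p q, (FProg.seq p q).run d s' = q.run d (p.run d s') := fun _ _ => rfl
      rw [Memory.writeNat_nat_of_ne _ _ _ (by decide), Memory.writeNat_real, hrun,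
        Finset.range_add_one, Finset.filter_insert]
      by_cases hl : k * n < m
      · rw [FProg.run_ifThen_of_holds d
          (by simp only [Test.Holds, var, NExp.val, h1]; omega), if_pos hl,
          Finset.card_insert_of_notMem (by simp)]
        constructor
        · simp [setVar, setRVar, FProg.run, NExp.val, var, h1]
          ring
        · simp [setVar, setRVar, FProg.run, NExp.val, RExp.val, rvar, h2, hr0]
          ring
      · rw [FProg.run_ifThen_of_not_holds d
          (by simp only [Test.Holds, var, NExp.val, h1]; omega), if_neg hl]
        constructor
        · simp [setVar, FProg.run, NExp.val, var, h1]
          ring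
        · simp [setVar, FProg.run, h2])
  exact key.2

theorem writeOutput_spec (s : Memory) (j : ℕ) (hj : j < m) :
    (writeOutput.run d s).nat 0 j = s.nat 1 j - 1 := by
  have key := FProg.run_forTo_induction d (x := 10) (c := true)
    (p := .setNat 0 (var 10) (.sub (.arr 1 (var 10)) (.const 1)))
    (s := s)
    (fun k s' => ∀ j < k, s'.nat 0 j = s.nat 1 j - 1)
    (by simp)
    (by
      intro k _ s' hk hn _ hI j hj
      rw [Memory.writeNat_nat_of_ne _ _ _ (by decide)]
      simp only [FProg.run, var, NExp.val, hk, hn 1 (by decide), Memory.writeNat_nat_self,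
        Function.update_apply]
      split_ifs with h
      · rw [h]
      · exact hI j (by omega))
  exact key j hj

variable {d} {ρ S : ℝ}

/-- All chores of the block number `b` are owned by different agents, whose bids were allowed. -/
structure BlockDone (d : Fin n → Fin m → ℝ) (ρ S : ℝ) (b : ℕ) (own : ℕ → ℕ) : Prop where
  owned : ∀ j ∈ block n m b, ∃ i < n, own j = i + 1 ∧ Allowed d ρ S (b * n) own j i
  inj : ∀ j ∈ block n m b, ∀ j' ∈ block n m b, own j = own j' → j = j'

/-- In a typical instance, the auctions assign all chores. -/
theorem allBlocks_spec (hd : Typical d ρ S) (hn : 0 < n) (hnm : 2 * n ≤ m) (s : Memory)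
    (h1 : ∀ j, s.nat 1 j = 0) (h2 : ∀ x, s.nat 2 x = 0) (h3 : s.nat 3 0 = 0)
    (hρ : s.real 0 0 = ρ) (hS : s.real 1 0 = S) :
    ∀ b < m, BlockDone d ρ S b ((allBlocks.run d s).nat 1) := by
  have key := FProg.run_forTo_induction d (x := 10) (c := true)
    (p := .seq runAuction (setVar 3 (.add (var 3) .agents))) (s := s)
    (fun k s' => s'.nat 3 0 = k * n ∧ (∀ b < k, BlockDone d ρ S b (s'.nat 1)) ∧
      (∀ j, k * n ≤ j → s'.nat 1 j = 0) ∧ ∀ x, k * n < x → s'.nat 2 x = 0)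
    (by
      simp only [Memory.writeNat_nat_of_ne _ _ _ (show 1 ≠ 10 by decide),
        Memory.writeNat_nat_of_ne _ _ _ (show 2 ≠ 10 by decide),
        Memory.writeNat_nat_of_ne _ _ _ (show 3 ≠ 10 by decide)]
      exact ⟨by omega, fun b hb => absurd hb (by omega), fun j _ => h1 j, fun x _ => h2 x⟩)
    (by
      rintro b _ s' hb hn' hr' ⟨e3, hdone, e1, e2⟩
      have eρ : s'.real 0 0 = ρ := by rw [hr' 0 (by decide), hρ]
      have eS : s'.real 1 0 = S := by rw [hr' 1 (by decide), hS]
      have hall : HallCondition n (block n m b) (Allowed d ρ S (b * n) (s'.nat 1)) := by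
        by_cases hbm : b * n < m
        · have hfirst : b = 1 → ∀ c < n, c ∈ block n m 0 := fun _ c hc => by
            rw [mem_block]; omega
          refine hd.hallCondition hnm hn hbm ?_ ?_
          · intro hb1 c hc i hi
            obtain ⟨i', hi', ho, ha⟩ := (hdone 0 (by omega)).owned c (hfirst hb1 c hc)
            obtain rfl : i = i' := by omega
            exact ⟨hi', ha.1⟩
          · intro hb1 c hc c' hc' hcc _
            exact (hdone 0 (by omega)).inj c (hfirst hb1 c hc) c' (hfirst hb1 c' hc') hcc
        · intro X hX
          have : X = ∅ := by
            refine Finset.eq_empty_of_forall_notMem fun j hj => ?_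
            have := mem_block.1 (hX hj)
            omega
          rw [this]; simp
      have start : BlockInv (n := n) (m := m) b (Allowed d ρ S (b * n) (s'.nat 1)) s' s' :=
        ⟨AuctionInv.start (fun j hj => e1 j (mem_block.1 hj).1)
          (fun i _ => e2 _ (by omega)), fun _ _ => rfl, fun _ _ => rfl⟩
      obtain ⟨hI, hass⟩ := start.auction (fun _ _ => Iff.rfl) (by omega) hall e3 eρ eS
      set u := runAuction.run d s' with hu
      have u3 : u.nat 3 = s'.nat 3 := FProg.run_nat_eq d _ _ (by decide)
      have hrun : (FProg.seq runAuction (setVar 3 (.add (var 3) .agents))).run d s' =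
          u.writeNat 3 0 ((b + 1) * n) := by
        simp only [FProg.run, ← hu, setVar, var, NExp.val, u3, e3, Nat.succ_mul]
      rw [hrun]
      simp only [Memory.writeNat_nat_of_ne _ _ _ (show 1 ≠ 10 by decide),
        Memory.writeNat_nat_of_ne _ _ _ (show 2 ≠ 10 by decide),
        Memory.writeNat_nat_of_ne _ _ _ (show 3 ≠ 10 by decide),
        Memory.writeNat_nat_of_ne _ _ _ (show 1 ≠ 3 by decide),
        Memory.writeNat_nat_of_ne _ _ _ (show 2 ≠ 3 by decide), Memory.writeNat_nat_self,
        Function.update_self]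
      have hbn : (b + 1) * n = b * n + n := Nat.succ_mul b n
      refine ⟨trivial, fun b' hb' => ?_, fun j hj => ?_, fun x hx => ?_⟩
      · rcases Nat.lt_succ_iff_lt_or_eq.1 hb' with hlt | rfl
        · have hle : b' * n + n ≤ b * n := by
            rw [← Nat.succ_mul]; exact Nat.mul_le_mul_right n hlt
          have hsame : ∀ j ∈ block n m b', u.nat 1 j = s'.nat 1 j := fun j hj =>
            hI.own_eq j (Or.inl ((mem_block.1 hj).2.1.trans_le hle))
          refine ⟨fun j hj => ?_, fun j hj j' hj' hjj => ?_⟩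
          · obtain ⟨i, hi, ho, ha⟩ := (hdone b' hlt).owned j hj
            refine ⟨i, hi, (hsame j hj).trans ho, (allowed_congr d (fun _ c hc => ?_) j i).1 ha⟩
            exact (hI.own_eq c (by left; omega)).symm
          · rw [hsame j hj, hsame j' hj'] at hjj
            exact (hdone b' hlt).inj j hj j' hj' hjj
        · refine ⟨fun j hj => ?_, fun j hj j' hj' hjj => ?_⟩
          · obtain ⟨i, hi⟩ := Nat.exists_eq_succ_of_ne_zero (hass j hj)
            obtain ⟨hin, ha⟩ := hI.inv.accepts j hj i hi
            refine ⟨i, hin, hi, (allowed_congr d (fun hbn' c hc => ?_) j i).1 ha⟩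
            exact (hI.own_eq c (by left; omega)).symm
          · exact hI.inv.inj j hj j' hj' hjj (hass j hj)
      · rw [hI.own_eq j (by right; omega)]
        exact e1 j (by omega)
      · rw [hI.price_eq x (by right; omega)]
        exact e2 x (by omega))
  exact key.2.1

/-- The algorithm succeeds on typical instances. -/
theorem findsEnvyFree_of_typical (hn : 0 < n) (hnm : 2 * n ≤ m)
    (hd : Typical d (scale n) (numBlocks n m * scale n)) :
    FindsEnvyFree d algorithm.compile := by
  set ρ := scale n with hρ
  set S := numBlocks n m * ρ with hS
  set s₁ := computeScale.run d Memory.init with hs₁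
  set s₂ := computeCap.run d s₁ with hs₂
  set s₃ := allBlocks.run d s₂ with hs₃
  have r₁ : s₁.real 0 0 = ρ := computeScale_spec d
  have c₁ : s₁.real 1 0 = 0 := congrFun (FProg.run_real_eq d _ _ (by decide)) 0
  have v₁ : s₁.nat 3 0 = 0 := congrFun (FProg.run_nat_eq d _ _ (by decide)) 0
  have r₂ : s₂.real 0 0 = ρ := (congrFun (FProg.run_real_eq d _ _ (by decide)) 0).trans r₁
  have c₂ : s₂.real 1 0 = S := by rw [hs₂, computeCap_spec d s₁ v₁ c₁, r₁]
  have v₂ : s₂.nat 3 0 = 0 := by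
    simp [hs₂, computeCap, FProg.run, setVar, NExp.val]
  have o₂ : ∀ j, s₂.nat 1 j = 0 := fun j =>
    (congrFun (FProg.run_nat_eq d _ _ (by decide)) j).trans
      (congrFun (FProg.run_nat_eq d _ _ (by decide)) j)
  have p₂ : ∀ j, s₂.nat 2 j = 0 := fun j =>
    (congrFun (FProg.run_nat_eq d _ _ (by decide)) j).trans
      (congrFun (FProg.run_nat_eq d _ _ (by decide)) j)
  have hdone := allBlocks_spec hd hn hnm s₂ o₂ p₂ v₂ r₂ c₂
  rw [← hs₃] at hdone
  have hblock : ∀ j < m, j / n < m ∧ j ∈ block n m (j / n) := by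
    intro j hj
    have := Nat.div_add_mod j n
    have := Nat.mod_lt j hn
    rw [mul_comm n] at *
    exact ⟨(Nat.div_le_self _ _).trans_lt hj, mem_block.2 ⟨by omega, by omega, hj⟩⟩
  have howner : ∀ j : Fin m, ∃ i : Fin n, s₃.nat 1 j = i + 1 ∧
      Allowed d ρ S ((j : ℕ) / n * n) (s₃.nat 1) j i := by
    intro j
    obtain ⟨i, hi, ho, ha⟩ := (hdone _ (hblock j j.2).1).owned j (hblock j j.2).2
    exact ⟨⟨i, hi⟩, ho, ha⟩
  choose A hA1 hA2 using howner
  refine ⟨A, ?_, ?_⟩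
  · obtain ⟨P, hP⟩ := FProg.exec_compile algorithm algorithm_wellFormed
    obtain ⟨t, ht, -⟩ := hP n m d Memory.init
    refine ⟨_, t, ht, fun j => ?_⟩
    have hrun : algorithm.run d Memory.init = writeOutput.run d s₃ := rfl
    rw [hrun, writeOutput_spec d s₃ j j.2, hA1 j]
    rfl
  · refine envyFree_of_blocks (ρ := ρ) (S := S) hd.nonneg hnm (by rw [hρ, scale]; positivity)
      le_rfl ?_ ?_ ?_
    · intro b j j' hj hj' hjj
      have hbm : b < m := by
        have := mem_block.1 hj
        exact (Nat.le_mul_of_pos_right b hn).trans_lt (this.1.trans_lt this.2.2)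
      exact Fin.ext ((hdone b hbm).inj j hj j' hj' (by rw [hA1, hA1, hjj]))
    · intro j
      have := (hA2 j).1
      rwa [readInput_fin] at this
    · intro j c hc hj hcj i hi ⟨hic, hij⟩
      have hj' := mem_block.1 hj
      have hc' := mem_block.1 hc
      have hjn : (j : ℕ) / n * n = n := by
        rw [Nat.div_eq_of_lt_le (k := 1) (by omega) (by omega), one_mul]
      refine (hA2 j).2 i i.2 c (by omega) ⟨hjn, ?_, ?_, ?_, ?_⟩
      · rw [hA1 c, hcj]
      · exact fun h => hi (Fin.ext h)
      · rwa [readInput_fin]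
      · rwa [readInput_fin]

end

theorem algorithm_runsInPolynomialTime : RunsInPolynomialTime algorithm.compile := by
  obtain ⟨P, hP⟩ := FProg.exec_compile algorithm algorithm_wellFormed
  refine ⟨P, fun n m d => ?_⟩
  obtain ⟨t, h1, h2⟩ := hP n m d Memory.init
  exact ⟨_, t, h1, h2⟩

end ChoreDivision

end

/-- The probability that the program fails to find an envy-free allocation tends to `0`, as
`n → ∞`, uniformly in all numbers `m` of chores in the range `2 * n ≤ m ≤ n ^ (8 / 7)`; a bound on
the measure of the failure set implies the bound `1 - ε ≤ …` on that of its complement. -/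
theorem mainTheorem5 (D : Measure ℝ) [IsProbabilityMeasure D]
    (hD : ChoreDivision.PDFBounded D) :
    ∃ p : ChoreDivision.Prog, ChoreDivision.RunsInPolynomialTime p ∧
      ∀ ε : ℝ, 0 < ε → ∀ᶠ n : ℕ in atTop, ∀ m : ℕ,
        2 * n ≤ m → (m : ℝ) ≤ (n : ℝ) ^ ((8 : ℝ) / 7) →
        ChoreDivision.instanceLaw D n m
          {d : Fin n → Fin m → ℝ | ¬ ChoreDivision.FindsEnvyFree d p} ≤ ENNReal.ofReal ε := by
  refine ⟨ChoreDivision.algorithm.compile, ChoreDivision.algorithm_runsInPolynomialTime,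
    fun ε hε => ?_⟩
  filter_upwards [ChoreDivision.eventually_typical D hD hε, eventually_gt_atTop 0]
    with n h hn m hm1 hm2
  refine (measure_mono ?_).trans (h m hm1 hm2)
  intro d hd ht
  exact hd (ChoreDivision.findsEnvyFree_of_typical hn hm1 ht)
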